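/- All graphs are finite, simple and undirected. For a graph $G=(V,E)$, a set $S\subseteq V$ is a \emph{connected dominating set} if every vertex of $G$ is in $S$ or has a neighbor in $S$, and $S$ is non-empty and induces a connected subgraph. The graph $G$ is \emph{connected-domishold} if there exist $w:V\to\mathbb{R}_{\ge 0}$ and $t\in\mathbb{R}_{\ge 0}$ such that for every $S\subseteq V$, $\sum_{x\in S}w(x)\ge t$ if and only if $S$ is a connected dominating set of $G$ (in particular, disconnected graphs are connected-domishold); it is \emph{hereditarily connected-domishold} if every induced subgraph of $G$ is connected-domishold. A \emph{cutset} of $G$ is a set $S\subseteq V$ such that $G-S$ is disconnected, that is, has at least two connected components. The \emph{cutset hypergraph} of $G$ has vertex set $V$, and its hyperedges are the inclusion-minimal cutsets of $G$ (so if $G$ is disconnected, its only hyperedge is $\emptyset$). A hypergraph $\mathcal{H}$ with finite vertex set $V$ and hyperedge set $\mathcal{E}$ is \emph{$1$-Sperner} if $\min\{|e\setminus f|,|f\setminus e|\}=1$ for every two distinct hyperedges $e,f$; \emph{threshold} if there exist $w:V\to\mathbb{R}_{\ge 0}$ and $t\in\mathbb{R}$ such that for every $X\subseteq V$, $\sum_{x\in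 X}w(x)\le t$ if and only if $X$ contains no hyperedge (when $\emptyset\notin\mathcal{E}$, this forces $t\ge 0$); and \emph{$2$-asummable} if there are no (not necessarily distinct) sets $A_1,A_2,B_1,B_2\subseteq V$ such that each $A_i$ contains a hyperedge, neither $B_i$ contains a hyperedge, and $|\{i: v\in A_i\}|=|\{i: v\in B_i\}|$ for every $v\in V$. A graph is \emph{chordal} if it has no induced cycle of order at least $4$, and it is $\mathcal F$-free if it has no induced subgraph isomorphic to a member of $\mathcal F$. Let $F_1$ be the square of the path on six vertices, that is, the graph with vertices $0,\dots,5$ in which $i\ne j$ are adjacent if and only if $|i-j|\le 2$. Let $F_2$ be $F_1$ with the edge $\{1,4\}$ added, that is, the graph obtained from a $K_4$ on $\{1,2,3,4\}$ by adding a vertex $0$ adjacent exactly to $1,2$ and a vertex $5$ adjacent exactly to $3,4$. For $n\ge1$, let $H_n$ be the graph with vertices $x_1,x_2,x_3,y_1,\dots,y_n,z_1,z_2,z_3$ and edges $x_1x_2,\,x_1x_3,\,x_2x_3,\,x_2y_1,\,x_3y_1$; $y_iy_{i+1}$ for $1\le i<n$; and $y_nz_2,\,y_nz_3,\,z_2z_3,\,z_1z_2,\,z_1z_3$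 (two diamonds joined by a path between a tip of one and a tip of the other, the two tips coinciding if $n=1$). \textbf{Theorem.} For every graph $G$, the following are equivalent: \begin{enumerate} \item $G$ is hereditarily connected-domishold. \item The cutset hypergraph of every induced subgraph of $G$ is $1$-Sperner. \item The cutset hypergraph of every induced subgraph of $G$ is threshold. \item The cutset hypergraph of every induced subgraph of $G$ is $2$-asummable. \item $G$ is an $\{F_1,F_2,H_1,H_2,\dots\}$-free chordal graph. \end{enumerate} -/

import Mathlib

/-! ## Connected dominating sets and connected-domishold graphs -/

/-- `S` is a connected dominating set of `G`: every vertex is in `S` or has a neighbour in `S`,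
and the subgraph induced by `S` is connected (in particular `S` is nonempty). -/
def SimpleGraph.IsConnDominating {V : Type*} (G : SimpleGraph V) (S : Set V) : Prop :=
  (∀ v, v ∈ S ∨ ∃ u ∈ S, G.Adj v u) ∧ (G.induce S).Connected

/-- `G` is connected-domishold: there are non-negative vertex weights and a non-negative threshold
such that the connected dominating sets are exactly the vertex sets of weight at least the
threshold. The notion is meant for graphs with finitely many vertices. -/
def SimpleGraph.IsConnDomishold {V : Type*} (G : SimpleGraph V) : Prop :=
  ∃ (w : V → ℝ) (t : ℝ), (∀ v, 0 ≤ w v) ∧ 0 ≤ t ∧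
    ∀ S : Set V, t ≤ ∑ᶠ x ∈ S, w x ↔ G.IsConnDominating S

/-- `G` is hereditarily connected-domishold: every induced subgraph is connected-domishold. -/
def SimpleGraph.IsHereditarilyConnDomishold {V : Type*} (G : SimpleGraph V) : Prop :=
  ∀ U : Set V, (G.induce U).IsConnDomishold

/-! ## Cutsets and the cutset hypergraph -/

/-- `S` is a cutset of `G`: the graph `G - S` is disconnected, that is, it has two vertices that
are not joined by a path. (The graph without vertices is not disconnected, so complete graphs have
no cutsets.) -/
def SimpleGraph.IsCutset {V : Type*} (G : SimpleGraph V) (S : Set V) : Prop :=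
  ¬ (G.induce Sᶜ).Preconnected

/-- The cutset hypergraph of `G`: its vertices are the vertices of `G` and its hyperedges are the
inclusion-minimal cutsets of `G`. -/
def SimpleGraph.cutsetHypergraph {V : Type*} (G : SimpleGraph V) : Hypergraph V where
  vertexSet := Set.univ
  edgeSet := {S | Minimal G.IsCutset S}
  subset_vertexSet_of_mem_edgeSet' _ _ := Set.subset_univ _

/-! ## Properties of (finite) hypergraphs -/

/-- `H` is 1-Sperner: `min {|e \ f|, |f \ e|} = 1` for all distinct hyperedges `e` and `f`. -/
def Hypergraph.IsOneSperner {α : Type*} (H : Hypergraph α) : Prop :=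
  ∀ e ∈ H.edgeSet, ∀ f ∈ H.edgeSet, e ≠ f → min (e \ f).ncard (f \ e).ncard = 1

/-- The vertex set `X` contains some hyperedge of `H`. -/
def Hypergraph.ContainsEdge {α : Type*} (H : Hypergraph α) (X : Set α) : Prop :=
  ∃ e ∈ H.edgeSet, e ⊆ X

/-- `H` is threshold: there are non-negative vertex weights and a threshold `t` such that a vertex
set has weight at most `t` if and only if it contains no hyperedge. If `∅` is not a hyperedge, then
`t` is automatically non-negative, since `∅` has weight `0`. If `∅` is a hyperedge, then every
vertex set contains a hyperedge and any negative `t` works. -/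
def Hypergraph.IsThreshold {α : Type*} (H : Hypergraph α) : Prop :=
  ∃ (w : α → ℝ) (t : ℝ), (∀ v, 0 ≤ w v) ∧
    ∀ X ⊆ H.vertexSet, ∑ᶠ x ∈ X, w x ≤ t ↔ ¬ H.ContainsEdge X

/-- `H` is `k`-summable: for some `r` with `2 ≤ r ≤ k` there are vertex sets `A₁, …, Aᵣ`, each
containing a hyperedge, and `B₁, …, Bᵣ`, none containing a hyperedge, such that every vertex lies
in as many of the `Aᵢ` as of the `Bᵢ`. -/
def Hypergraph.IsSummable {α : Type*} (H : Hypergraph α) (k : ℕ) : Prop :=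
  ∃ r : ℕ, 2 ≤ r ∧ r ≤ k ∧ ∃ A B : Fin r → Set α,
    (∀ i, A i ⊆ H.vertexSet ∧ H.ContainsEdge (A i)) ∧
    (∀ i, B i ⊆ H.vertexSet ∧ ¬ H.ContainsEdge (B i)) ∧
    ∀ v ∈ H.vertexSet, {i | v ∈ A i}.ncard = {i | v ∈ B i}.ncard

/-- `H` is `k`-asummable: it is not `k`-summable. -/
def Hypergraph.IsAsummable {α : Type*} (H : Hypergraph α) (k : ℕ) : Prop :=
  ¬ H.IsSummable k

/-! ## Chordal graphs and the forbidden induced subgraphs -/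

/-- `G` is chordal: it has no induced cycle of order at least 4. -/
def SimpleGraph.IsChordal {V : Type*} (G : SimpleGraph V) : Prop :=
  ∀ k : ℕ, 4 ≤ k → ¬ (SimpleGraph.cycleGraph k).IsIndContained G

/-- The graph `F₁`: the square of the path on the six vertices `0, 1, 2, 3, 4, 5`. -/
def graphF1 : SimpleGraph (Fin 6) :=
  SimpleGraph.fromRel fun i j => j.val = i.val + 1 ∨ j.val = i.val + 2

/-- The graph `F₂`: a complete graph on `1, 2, 3, 4`, together with a vertex `0` adjacent exactly
to `1` and `2`, and a vertex `5` adjacent exactly to `3` and `4`. It is `F₁` plus the edge `14`. -/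
def graphF2 : SimpleGraph (Fin 6) :=
  SimpleGraph.fromRel fun i j =>
    (j.val = i.val + 1 ∨ j.val = i.val + 2) ∨ (i = 1 ∧ j = 4)

/-- Half of the adjacency relation of `Hₙ`, see `graphH`. -/
def graphHRel (n : ℕ) : Fin 3 ⊕ Fin n ⊕ Fin 3 → Fin 3 ⊕ Fin n ⊕ Fin 3 → Prop
  | .inl _, .inl _ => True
  | .inr (.inr _), .inr (.inr _) => True
  | .inr (.inl i), .inr (.inl j) => j.val = i.val + 1
  | .inl a, .inr (.inl i) => a ≠ 0 ∧ i.val = 0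
  | .inr (.inl i), .inr (.inr b) => i.val + 1 = n ∧ b ≠ 0
  | _, _ => False

/-- The graph `Hₙ`, for `n ≥ 1`, on the vertices `x₁, x₂, x₃, y₁, …, yₙ, z₁, z₂, z₃` (indexed from
`0` in the code): a diamond on `x₁, x₂, x₃, y₁` with tips `x₁, y₁`, a diamond on `yₙ, z₁, z₂, z₃`
with tips `yₙ, z₁`, and the path `y₁ y₂ … yₙ` (which is a single vertex if `n = 1`) joining them,
with no other edges. -/
def graphH (n : ℕ) : SimpleGraph (Fin 3 ⊕ Fin n ⊕ Fin 3) :=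
  SimpleGraph.fromRel (graphHRel n)

/-!
The implications run `1 ↔ 3`, `2 → 3 → 4 → 5 → 2`.

`1 ↔ 3`: if `G` has a cutset, its connected dominating sets are the complements of the sets that
contain no cutset, so complementation turns a separating weight function for one family into one
for the other; if `G` has no cutset, both separations are trivial
(`SimpleGraph.isConnDomishold_iff_isThreshold`).

`2 → 3`: a 1-Sperner hypergraph is threshold. It has a vertex `z` such that every hyperedge
avoiding `z` contains all of `g \ {z}` for every hyperedge `g` containing `z`; thus it is glued from
two smaller 1-Sperner hypergraphs, whose weights can be combined
(`IsOneSpernerFamily.exists_weights`).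

`3 → 4` follows by adding up weights. For `4 → 5`, each forbidden induced subgraph has two cutsets
with the same multiset union as two sets whose complements are connected dominating sets.

`5 → 2` is the structural part (`SimpleGraph.IsChordal.isOneSperner_cutsetHypergraph`). Let `S` and
`S'` be minimal cutsets of a chordal graph that violate the 1-Sperner condition. Minimal cutsets are
cliques all of whose vertices have neighbours in all components of the rest, so there are a vertex
`x` adjacent to two vertices of `S \ S'`, and a vertex `x'` adjacent to two vertices of `S' \ S`,
that have distance at least 3 in `G - (S ∩ S')` and are not separated there by a neighbour of `x` or
`x'`. If some vertex of `G - (S ∩ S')` separates `x` from `x'`, consider a chordless path between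
them: the first and the last separating vertex on it are tips of diamonds pointing away from each
other, which gives an induced `Hₙ` (`SimpleGraph.IsChordal.exists_graphH_isIndContained`). If there
is no such vertex, move `x` and `x'` towards each other as long as possible; then the cliques
through which `x` sees `x'` and `x'` sees `x` are so densely joined that an induced `F₁` or `F₂`
appears (`SimpleGraph.IsInseparablePair.isIndContained`).
-/

/-! ### Walks inside a vertex set -/

namespace SimpleGraph

variable {V : Type*} {G : SimpleGraph V} {W W' K : Set V} {u v w x y : V}

/-- `u` and `v` are joined by a walk of `G` all of whose vertices lie in `W`. This is reachability
in `G.induce W`, phrased without passing to the subtype. -/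
def JoinedWithin (G : SimpleGraph V) (W : Set V) (u v : V) : Prop :=
  ∃ p : G.Walk u v, ∀ z ∈ p.support, z ∈ W

lemma JoinedWithin.refl (h : u ∈ W) : G.JoinedWithin W u u := ⟨.nil, by simpa using h⟩

lemma JoinedWithin.symm (h : G.JoinedWithin W u v) : G.JoinedWithin W v u := by
  obtain ⟨p, hp⟩ := h
  exact ⟨p.reverse, by simpa using hp⟩

lemma JoinedWithin.trans (h : G.JoinedWithin W u v) (h' : G.JoinedWithin W v w) :
    G.JoinedWithin W u w := by
  obtain ⟨p, hp⟩ := h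
  obtain ⟨q, hq⟩ := h'
  refine ⟨p.append q, fun z hz => ?_⟩
  rcases (Walk.mem_support_append_iff p q).1 hz with hz | hz
  exacts [hp z hz, hq z hz]

lemma JoinedWithin.mono (h : G.JoinedWithin W u v) (hW : W ⊆ W') : G.JoinedWithin W' u v := by
  obtain ⟨p, hp⟩ := h
  exact ⟨p, fun z hz => hW (hp z hz)⟩

lemma JoinedWithin.left_mem (h : G.JoinedWithin W u v) : u ∈ W := by
  obtain ⟨p, hp⟩ := h
  exact hp _ p.start_mem_support

lemma JoinedWithin.right_mem (h : G.JoinedWithin W u v) : v ∈ W := h.symm.left_mem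

lemma Adj.joinedWithin (h : G.Adj u v) (hu : u ∈ W) (hv : v ∈ W) : G.JoinedWithin W u v :=
  ⟨h.toWalk, by simp [hu, hv]⟩

/-- A walk inside `W` from a vertex of `K` to a vertex outside `K` leaves `K` along some edge. -/
lemma JoinedWithin.exists_exit (h : G.JoinedWithin W u v) (hu : u ∈ K) (hv : v ∉ K) :
    ∃ y z, y ∈ K ∧ z ∉ K ∧ y ∈ W ∧ z ∈ W ∧ G.Adj y z := by
  obtain ⟨p, hp⟩ := h
  obtain ⟨d, hd, h1, h2⟩ := p.exists_boundary_dart K hu hv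
  exact ⟨d.fst, d.snd, h1, h2, hp _ (p.dart_fst_mem_support_of_mem_darts hd),
    hp _ (p.dart_snd_mem_support_of_mem_darts hd), d.adj⟩

/-- If no edge of `W` leaves `K`, a walk inside `W` that starts in `K` stays in `K`. -/
lemma JoinedWithin.within_of_closed (h : G.JoinedWithin W u v) (hu : u ∈ K)
    (hK : ∀ y z, y ∈ K → z ∈ W → G.Adj y z → z ∈ K) : G.JoinedWithin (W ∩ K) u v := by
  obtain ⟨p, hp⟩ := h
  refine ⟨p, fun z hz => ⟨hp z hz, ?_⟩⟩
  classical
  by_contra hzK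
  have : G.JoinedWithin W u z :=
    ⟨p.takeUntil z hz, fun t ht => hp t (p.support_takeUntil_subset_support hz ht)⟩
  obtain ⟨a, b, ha, hb, -, hbW, hab⟩ := this.exists_exit hu hzK
  exact hb (hK a b ha hbW hab)

lemma JoinedWithin.map {V' : Type*} {G' : SimpleGraph V'} (f : G →g G')
    (h : G.JoinedWithin W u v) : G'.JoinedWithin (f '' W) (f u) (f v) := by
  obtain ⟨p, hp⟩ := h
  refine ⟨p.map f, fun z hz => ?_⟩
  rw [Walk.support_map, List.mem_map] at hz
  obtain ⟨t, ht, rfl⟩ := hz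
  exact ⟨t, hp t ht, rfl⟩

lemma reachable_iff_joinedWithin_univ : G.Reachable u v ↔ G.JoinedWithin Set.univ u v :=
  ⟨fun ⟨p⟩ => ⟨p, by simp⟩, fun ⟨p, _⟩ => ⟨p⟩⟩

/-- Walks of an induced subgraph are walks of the graph. -/
lemma joinedWithin_induce_iff {U : Set V} {W : Set U} {u v : U} :
    (G.induce U).JoinedWithin W u v ↔ G.JoinedWithin ((↑) '' W) (u : V) v := by
  refine ⟨fun h => h.map (Embedding.induce U).toHom, ?_⟩
  rintro ⟨p, hp⟩
  have hU : ∀ z ∈ p.support, z ∈ U := fun z hz => by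
    obtain ⟨t, -, rfl⟩ := hp z hz
    exact t.2
  refine ⟨p.induce U hU, fun z hz => ?_⟩
  rw [Walk.support_induce, List.mem_attachWith] at hz
  obtain ⟨t, ht, h⟩ := hp _ hz
  rwa [← Subtype.ext h]

lemma reachable_induce_iff (hu : u ∈ W) (hv : v ∈ W) :
    (G.induce W).Reachable ⟨u, hu⟩ ⟨v, hv⟩ ↔ G.JoinedWithin W u v := by
  rw [reachable_iff_joinedWithin_univ, joinedWithin_induce_iff, Set.image_univ,
    Subtype.range_coe]

lemma induce_preconnected_iff :
    (G.induce W).Preconnected ↔ ∀ u ∈ W, ∀ v ∈ W, G.JoinedWithin W u v :=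
  ⟨fun h _ hu _ hv => (reachable_induce_iff hu hv).1 (h _ _),
    fun h u v => (reachable_induce_iff u.2 v.2).2 (h _ u.2 _ v.2)⟩

lemma induce_connected_iff :
    (G.induce W).Connected ↔ W.Nonempty ∧ ∀ u ∈ W, ∀ v ∈ W, G.JoinedWithin W u v := by
  rw [connected_iff, induce_preconnected_iff, Set.nonempty_coe_sort, and_comm]

lemma isCutset_iff {S : Set V} :
    G.IsCutset S ↔ ∃ u ∈ Sᶜ, ∃ v ∈ Sᶜ, ¬ G.JoinedWithin Sᶜ u v := by
  rw [IsCutset, induce_preconnected_iff]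
  push Not
  rfl

/-! ### Cutsets and connected dominating sets -/

lemma exists_minimal_isCutset_subset [Finite V] {S : Set V} (h : G.IsCutset S) :
    ∃ T ⊆ S, Minimal G.IsCutset T := by
  obtain ⟨T, hT, hm⟩ := exists_minimal_le_of_wellFoundedLT G.IsCutset S h
  exact ⟨T, hT, hm⟩

lemma containsEdge_cutsetHypergraph_iff [Finite V] {X : Set V} :
    G.cutsetHypergraph.ContainsEdge X ↔ ∃ S ⊆ X, G.IsCutset S :=
  ⟨fun ⟨e, he, heX⟩ => ⟨e, heX, he.1⟩, fun ⟨_, hS, h⟩ =>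
    have ⟨T, hT, hm⟩ := exists_minimal_isCutset_subset h
    ⟨T, hm, hT.trans hS⟩⟩

lemma IsConnDominating.joinedWithin_of_subset {S T : Set V} (h : G.IsConnDominating S)
    (hST : S ⊆ T) (hu : u ∈ T) (hv : v ∈ T) : G.JoinedWithin T u v := by
  have key : ∀ a ∈ T, ∃ b ∈ S, G.JoinedWithin T a b := fun a ha => by
    rcases h.1 a with h1 | ⟨b, hb, hab⟩
    · exact ⟨a, h1, .refl ha⟩
    · exact ⟨b, hb, hab.joinedWithin ha (hST hb)⟩
  obtain ⟨a, ha, h1⟩ := key u hu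
  obtain ⟨b, hb, h2⟩ := key v hv
  exact h1.trans ((((induce_connected_iff.1 h.2).2 a ha b hb).mono hST).trans h2.symm)

lemma IsConnDominating.not_containsEdge_compl [Finite V] {S : Set V} (h : G.IsConnDominating S) :
    ¬ G.cutsetHypergraph.ContainsEdge Sᶜ := by
  rw [containsEdge_cutsetHypergraph_iff]
  rintro ⟨T, hT, hcut⟩
  obtain ⟨u, hu, v, hv, huv⟩ := isCutset_iff.1 hcut
  exact huv (h.joinedWithin_of_subset (Set.subset_compl_comm.1 hT) hu hv)

lemma not_containsEdge_iff [Finite V] {X : Set V} :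
    ¬ G.cutsetHypergraph.ContainsEdge X ↔
      ∀ T, Xᶜ ⊆ T → ∀ u ∈ T, ∀ v ∈ T, G.JoinedWithin T u v := by
  rw [containsEdge_cutsetHypergraph_iff]
  constructor
  · intro h T hT u hu v hv
    by_contra hc
    refine h ⟨Tᶜ, Set.compl_subset_comm.1 hT, isCutset_iff.2 ⟨u, ?_, v, ?_, ?_⟩⟩ <;> simpa
  · rintro h ⟨S, hS, hc⟩
    obtain ⟨u, hu, v, hv, huv⟩ := isCutset_iff.1 hc
    exact huv (h _ (Set.compl_subset_compl.2 hS) u hu v hv)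

/-- The nonempty transversals of the cutset hypergraph are the connected dominating sets. -/
lemma isConnDominating_iff_of_nonempty [Finite V] {S : Set V} (hS : S.Nonempty) :
    G.IsConnDominating S ↔ ¬ G.cutsetHypergraph.ContainsEdge Sᶜ := by
  refine ⟨fun h => h.not_containsEdge_compl, fun h => ?_⟩
  rw [not_containsEdge_iff, compl_compl] at h
  refine ⟨fun v => ?_, induce_connected_iff.2 ⟨hS, h S le_rfl⟩⟩
  by_cases hv : v ∈ S
  · exact .inl hv
  obtain ⟨s, hs⟩ := hS
  have hjoin := h (insert v S) (Set.subset_insert _ _) v (.inl rfl) s (.inr hs)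
  obtain ⟨a, b, ha, hb, -, hb', hab⟩ := hjoin.exists_exit (K := {v}) rfl
    (fun hsv => hv (hsv ▸ hs))
  rw [Set.mem_singleton_iff] at ha hb
  subst ha
  exact .inr ⟨b, hb'.resolve_left hb, hab⟩

/-- If there is a cutset at all, the connected dominating sets are the transversals of the cutset
hypergraph: the empty set is neither. -/
lemma isConnDominating_iff [Finite V] {T : Set V} (hT : G.IsCutset T) {S : Set V} :
    G.IsConnDominating S ↔ ¬ G.cutsetHypergraph.ContainsEdge Sᶜ := by
  rcases S.eq_empty_or_nonempty with rfl | hS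
  · refine ⟨fun h => absurd (induce_connected_iff.1 h.2).1 (by simp), fun h => absurd ?_ h⟩
    exact containsEdge_cutsetHypergraph_iff.2 ⟨T, by simp, hT⟩
  · exact isConnDominating_iff_of_nonempty hS

lemma finsum_mem_compl [Finite V] (f : V → ℝ) (S : Set V) :
    ∑ᶠ x ∈ Sᶜ, f x = ∑ᶠ x, f x - ∑ᶠ x ∈ S, f x := by
  have h := finsum_mem_union (f := f) (disjoint_compl_right (a := S)) S.toFinite Sᶜ.toFinite
  rw [Set.union_compl_self, finsum_mem_univ] at h
  linarith

/-- Complementation turns a linear separation of the connected dominating sets into one of the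
sets without a cutset, with the same weights. -/
theorem isConnDomishold_iff_isThreshold [Finite V] :
    G.IsConnDomishold ↔ G.cutsetHypergraph.IsThreshold := by
  by_cases hc : ∃ T, G.IsCutset T
  · obtain ⟨T, hT⟩ := hc
    have huniv : G.cutsetHypergraph.ContainsEdge Set.univ :=
      containsEdge_cutsetHypergraph_iff.2 ⟨T, Set.subset_univ _, hT⟩
    constructor
    · rintro ⟨w, t, hw, -, h⟩
      refine ⟨w, ∑ᶠ x, w x - t, hw, fun X _ => ?_⟩
      rw [← compl_compl X, ← isConnDominating_iff hT, ← h, compl_compl X, finsum_mem_compl]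
      constructor <;> intro h <;> linarith
    · rintro ⟨w, t, hw, h⟩
      refine ⟨w, ∑ᶠ x, w x - t, hw, ?_, fun S => ?_⟩
      · have := (h Set.univ le_rfl).not.2 (not_not.2 huniv)
        rw [finsum_mem_univ] at this
        linarith
      · rw [isConnDominating_iff hT, ← h _ (Set.subset_univ _), finsum_mem_compl]
        constructor <;> intro h <;> linarith
  · have hno : ∀ X, ¬ G.cutsetHypergraph.ContainsEdge X := fun X hX =>
      have ⟨S, _, hS⟩ := containsEdge_cutsetHypergraph_iff.1 hX
      hc ⟨S, hS⟩
    refine iff_of_true ⟨fun _ => 1, 1, fun _ => zero_le_one, zero_le_one, fun S => ?_⟩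
      ⟨0, 0, fun _ => le_rfl, fun X _ => by simp [hno]⟩
    rcases S.eq_empty_or_nonempty with rfl | hS
    · refine iff_of_false (by norm_num) fun h => ?_
      exact absurd (induce_connected_iff.1 h.2).1 (by simp)
    · refine iff_of_true ?_ ((isConnDominating_iff_of_nonempty hS).2 (hno _))
      rw [finsum_mem_eq_finite_toFinset_sum _ S.toFinite]
      simpa [Finset.one_le_card, Nat.one_le_cast] using hS

end SimpleGraph

/-! ### Threshold hypergraphs are asummable -/

lemma sum_finsum_mem_eq_of_ncard_eq {α ι : Type*} [Finite α] [Fintype ι] (w : α → ℝ)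
    {A B : ι → Set α} (h : ∀ v, {i | v ∈ A i}.ncard = {i | v ∈ B i}.ncard) :
    ∑ i, ∑ᶠ x ∈ A i, w x = ∑ i, ∑ᶠ x ∈ B i, w x := by
  classical
  have := Fintype.ofFinite α
  have key : ∀ C : ι → Set α, ∑ i, ∑ᶠ x ∈ C i, w x = ∑ v, ({i | v ∈ C i}.ncard : ℝ) * w v := by
    intro C
    have h1 : ∀ i, ∑ᶠ x ∈ C i, w x = ∑ v, if v ∈ C i then w v else 0 := fun i => by
      rw [finsum_mem_def, finsum_eq_sum_of_fintype]
      simp [Set.indicator_apply]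
    simp_rw [h1]
    rw [Finset.sum_comm]
    refine Finset.sum_congr rfl fun v _ => ?_
    rw [← Finset.sum_filter, Finset.sum_const, nsmul_eq_mul, Set.ncard_eq_toFinset_card']
    congr 3
    ext; simp
  rw [key, key]
  simp_rw [h]

theorem Hypergraph.IsThreshold.isAsummable {α : Type*} [Finite α] {H : Hypergraph α}
    (hH : H.IsThreshold) (huniv : H.vertexSet = Set.univ) (k : ℕ) : H.IsAsummable k := by
  rintro ⟨r, hr, -, A, B, hA, hB, hAB⟩
  obtain ⟨w, t, -, h⟩ := hH
  have h1 := sum_finsum_mem_eq_of_ncard_eq w (A := A) (B := B) fun v => hAB v (huniv ▸ trivial)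
  have h2 : ∑ i, ∑ᶠ x ∈ B i, w x ≤ ∑ i : Fin r, t :=
    Finset.sum_le_sum fun i _ => (h _ (hB i).1).2 (hB i).2
  have h3 : ∑ i : Fin r, t < ∑ i, ∑ᶠ x ∈ A i, w x := by
    refine Finset.sum_lt_sum_of_nonempty ⟨⟨0, by omega⟩, Finset.mem_univ _⟩ fun i _ => ?_
    exact not_le.1 fun hle => (h _ (hA i).1).1 hle (hA i).2
  linarith

/-! ### 1-Sperner hypergraphs are threshold -/

section OneSperner

open Finset

variable {α : Type*} [DecidableEq α] {E : Finset (Finset α)}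

/-- The 1-Sperner property for a finite family of finite sets. -/
def IsOneSpernerFamily (E : Finset (Finset α)) : Prop :=
  ∀ e ∈ E, ∀ f ∈ E, e ≠ f → min #(e \ f) #(f \ e) = 1

lemma IsOneSpernerFamily.card_sdiff_eq_one (hE : IsOneSpernerFamily E) {e f : Finset α}
    (he : e ∈ E) (hf : f ∈ E) (hne : e ≠ f) (hle : #e ≤ #f) : #(e \ f) = 1 := by
  have h := hE e he f hf hne
  have : #(e \ f) ≤ #(f \ e) := Finset.card_sdiff_le_card_sdiff_iff.2 hle
  omega

lemma eq_singleton_of_card_eq_one {α : Type*} {s : Finset α} (h : #s = 1) {z : α} (hz : z ∈ s) :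
    s = {z} := by
  obtain ⟨y, rfl⟩ := Finset.card_eq_one.1 h
  rw [Finset.mem_singleton.1 hz]

/-- The vertex along which a 1-Sperner family decomposes: every member avoiding `z` contains
`g \ {z}` for all members `g` containing `z`. It is the only element of `e \ f` for a smallest
member `e` and a largest member `f ≠ e`. -/
lemma IsOneSpernerFamily.exists_decomposing_vertex (hE : IsOneSpernerFamily E)
    (hne : E.Nonempty) (h0 : ∅ ∉ E) :
    ∃ z, (∃ g ∈ E, z ∈ g) ∧ ∀ g ∈ E, z ∈ g → ∀ f ∈ E, z ∉ f → g \ f = {z} := by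
  obtain ⟨e, he, hemin⟩ := E.exists_min_image card hne
  rcases (E.erase e).eq_empty_or_nonempty with hem | hne'
  · have hE1 : ∀ g ∈ E, g = e := fun g hg => by
      by_contra hge
      exact Finset.notMem_empty g (hem ▸ Finset.mem_erase.2 ⟨hge, hg⟩)
    obtain ⟨z, hz⟩ : e.Nonempty := Finset.nonempty_iff_ne_empty.2 fun h => h0 (h ▸ he)
    exact ⟨z, ⟨e, he, hz⟩, fun g _ _ f hf hzf => absurd (hE1 f hf ▸ hz) hzf⟩
  obtain ⟨f, hf, hfmax⟩ := (E.erase e).exists_max_image card hne'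
  obtain ⟨hfe, hf⟩ := Finset.mem_erase.1 hf
  obtain ⟨z, hz⟩ := Finset.card_eq_one.1
    (hE.card_sdiff_eq_one he hf (Ne.symm hfe) (hemin f hf))
  have hz' : z ∈ e ∧ z ∉ f := Finset.mem_sdiff.1 (hz ▸ Finset.mem_singleton_self z)
  refine ⟨z, ⟨e, he, hz'.1⟩, fun g hg hzg f' hf' hzf' => ?_⟩
  have hef' : e ≠ f' := fun h => hzf' (h ▸ hz'.1)
  rcases eq_or_ne g e with rfl | hge
  · exact eq_singleton_of_card_eq_one (hE.card_sdiff_eq_one he hf' hef' (hemin _ hf'))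
      (Finset.mem_sdiff.2 ⟨hzg, hzf'⟩)
  have hgf : g ≠ f := fun h => hz'.2 (h ▸ hzg)
  have hgf1 : g \ f = {z} := eq_singleton_of_card_eq_one
    (hE.card_sdiff_eq_one hg hf hgf (hfmax g (Finset.mem_erase.2 ⟨hge, hg⟩)))
    (Finset.mem_sdiff.2 ⟨hzg, hz'.2⟩)
  by_contra hcon
  have hgf' : g ≠ f' := fun h => hzf' (h ▸ hzg)
  -- Otherwise `f' \ g` is the singleton `e \ g`, and then `f' ⊂ f`.
  have hcard : #(f' \ g) = 1 := by
    have h1 := hE g hg f' hf' hgf'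
    have h2 : #(g \ f') ≠ 1 := fun h =>
      hcon (eq_singleton_of_card_eq_one h (Finset.mem_sdiff.2 ⟨hzg, hzf'⟩))
    omega
  have heg : #(e \ g) = 1 := hE.card_sdiff_eq_one he hg hge.symm (hemin g hg)
  obtain ⟨z', hz1⟩ := Finset.card_eq_one.1 heg
  have hz1' : z' ∈ e ∧ z' ∉ g := Finset.mem_sdiff.1 (hz1 ▸ Finset.mem_singleton_self z')
  have hef1 : e \ f' = {z} := eq_singleton_of_card_eq_one
    (hE.card_sdiff_eq_one he hf' hef' (hemin f' hf')) (Finset.mem_sdiff.2 ⟨hz'.1, hzf'⟩)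
  have hz'f' : z' ∈ f' := by
    by_contra h
    have := Finset.mem_sdiff.2 ⟨hz1'.1, h⟩
    rw [hef1, Finset.mem_singleton] at this
    exact hz1'.2 (this ▸ hzg)
  have hf'g : f' \ g = {z'} :=
    eq_singleton_of_card_eq_one hcard (Finset.mem_sdiff.2 ⟨hz'f', hz1'.2⟩)
  have hsub : f' ⊆ f := by
    intro v hv
    by_contra hvf
    by_cases hve : v ∈ e
    · have := Finset.mem_sdiff.2 ⟨hve, hvf⟩
      rw [hz, Finset.mem_singleton] at this
      exact hzf' (this ▸ hv)
    · by_cases hvg : v ∈ g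
      · have := Finset.mem_sdiff.2 ⟨hvg, hvf⟩
        rw [hgf1, Finset.mem_singleton] at this
        exact hve (this ▸ hz'.1)
      · have := Finset.mem_sdiff.2 ⟨hv, hvg⟩
        rw [hf'g, Finset.mem_singleton] at this
        exact hve (this ▸ hz1'.1)
  have hff' : f' ≠ f := fun h => hcon (h ▸ hgf1)
  have h1 := hE f' hf' f hf hff'
  rw [Finset.sdiff_eq_empty_iff_subset.2 hsub] at h1
  simp at h1

/-- Threshold weights with integer values for a 1-Sperner family. With `z` as in
`IsOneSpernerFamily.exists_decomposing_vertex` and `V₁` the union of the sets `g \ {z}`, `z ∈ g`,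
the family consists of the sets `e ∪ {z}` for `e` in a family `E₁` on `V₁`, and `e ∪ V₁` for `e` in
a family `E₂` off `V₁ ∪ {z}`. Both are 1-Sperner, and weights for them are combined by giving those
of `E₁` a large factor `M`. -/
theorem IsOneSpernerFamily.exists_weights [Fintype α] (hE : IsOneSpernerFamily E) :
    ∃ (w : α → ℤ) (t : ℤ), (∀ v, 0 ≤ w v) ∧
      ∀ X : Finset α, ∑ x ∈ X, w x ≤ t ↔ ∀ e ∈ E, ¬ e ⊆ X := by
  induction hn : #(E.sup id) using Nat.strong_induction_on generalizing E with
  | _ n ih =>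
  subst hn
  rcases E.eq_empty_or_nonempty with rfl | hne
  · exact ⟨0, 0, by simp, by simp⟩
  by_cases h0 : ∅ ∈ E
  · refine ⟨0, -1, by simp, fun X => iff_of_false (by simp) fun h => h ∅ h0 (by simp)⟩
  obtain ⟨z, ⟨g₀, hg₀, hzg₀⟩, hz⟩ := hE.exists_decomposing_vertex hne h0
  set E₁ : Finset (Finset α) := {e ∈ E | z ∈ e}.image fun e => e.erase z with hE₁
  set V₁ : Finset α := E₁.sup id with hV₁
  set E₂ : Finset (Finset α) := {e ∈ E | z ∉ e}.image fun e => e \ V₁ with hE₂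
  have hmem₁ : ∀ {e}, e ∈ E → z ∈ e → e.erase z ∈ E₁ := fun he hze =>
    Finset.mem_image.2 ⟨_, Finset.mem_filter.2 ⟨he, hze⟩, rfl⟩
  have hmem₂ : ∀ {e}, e ∈ E → z ∉ e → e \ V₁ ∈ E₂ := fun he hze =>
    Finset.mem_image.2 ⟨_, Finset.mem_filter.2 ⟨he, hze⟩, rfl⟩
  have hzV₁ : z ∉ V₁ := by
    simp [hV₁, hE₁, Finset.mem_sup]
  have hsubV₁ : ∀ e ∈ E₁, e ⊆ V₁ := fun e he => Finset.le_sup (f := id) he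
  have hV₁sub : ∀ f ∈ E, z ∉ f → V₁ ⊆ f := by
    intro f hf hzf v hv
    obtain ⟨e, he, hve⟩ := Finset.mem_sup.1 hv
    obtain ⟨g, hg, rfl⟩ := Finset.mem_image.1 he
    obtain ⟨hgE, hzg⟩ := Finset.mem_filter.1 hg
    obtain ⟨hvz, hvg⟩ := Finset.mem_erase.1 hve
    by_contra hvf
    have := Finset.mem_sdiff.2 ⟨hvg, hvf⟩
    rw [hz g hgE hzg f hf hzf, Finset.mem_singleton] at this
    exact hvz this
  have hS₁ : IsOneSpernerFamily E₁ := by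
    intro e he f hf hef
    obtain ⟨e, he', rfl⟩ := Finset.mem_image.1 he
    obtain ⟨f, hf', rfl⟩ := Finset.mem_image.1 hf
    obtain ⟨he, hze⟩ := Finset.mem_filter.1 he'
    obtain ⟨hf, hzf⟩ := Finset.mem_filter.1 hf'
    have h1 : ∀ a b : Finset α, z ∈ b → a.erase z \ b.erase z = a \ b := by
      intro a b hb; ext v
      simp only [Finset.mem_sdiff, Finset.mem_erase]
      grind
    rw [h1 _ _ hzf, h1 _ _ hze]
    exact hE e he f hf fun h => hef (h ▸ rfl)
  have hS₂ : IsOneSpernerFamily E₂ := by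
    intro e he f hf hef
    obtain ⟨e, he', rfl⟩ := Finset.mem_image.1 he
    obtain ⟨f, hf', rfl⟩ := Finset.mem_image.1 hf
    obtain ⟨he, hze⟩ := Finset.mem_filter.1 he'
    obtain ⟨hf, hzf⟩ := Finset.mem_filter.1 hf'
    have h1 : ∀ a b : Finset α, V₁ ⊆ b → (a \ V₁) \ (b \ V₁) = a \ b := by
      intro a b hb; ext v
      have := @hb v
      simp only [Finset.mem_sdiff]
      tauto
    rw [h1 _ _ (hV₁sub f hf hzf), h1 _ _ (hV₁sub e he hze)]
    exact hE e he f hf fun h => hef (h ▸ rfl)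
  have hsup : ∀ {E' : Finset (Finset α)}, (∀ e' ∈ E', ∃ e ∈ E, e' ⊆ e.erase z) →
      #(E'.sup id) < #(E.sup id) := by
    intro E' h
    refine Finset.card_lt_card ⟨fun v hv => ?_, fun h' => ?_⟩
    · obtain ⟨e', he', hv'⟩ := Finset.mem_sup.1 hv
      obtain ⟨e, he, hee'⟩ := h e' he'
      exact Finset.mem_sup.2 ⟨e, he, Finset.mem_of_mem_erase (hee' hv')⟩
    · obtain ⟨e', he', hv'⟩ := Finset.mem_sup.1 (h' (Finset.mem_sup.2 ⟨g₀, hg₀, hzg₀⟩))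
      obtain ⟨e, he, hee'⟩ := h e' he'
      exact Finset.notMem_erase z e (hee' hv')
  obtain ⟨w₁, t₁, hw₁, h₁⟩ := ih _ (hsup fun e' he' => by
    obtain ⟨e, he, rfl⟩ := Finset.mem_image.1 he'
    exact ⟨e, (Finset.mem_filter.1 he).1, subset_rfl⟩) hS₁ rfl
  obtain ⟨w₂, t₂, hw₂, h₂⟩ := ih _ (hsup fun e' he' => by
    obtain ⟨e, he, rfl⟩ := Finset.mem_image.1 he'
    refine ⟨e, (Finset.mem_filter.1 he).1, fun v hv => ?_⟩
    obtain ⟨hve, -⟩ := Finset.mem_sdiff.1 hv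
    exact Finset.mem_erase.2 ⟨fun h => (Finset.mem_filter.1 he).2 (h ▸ hve), hve⟩) hS₂ rfl
  -- Vertices of `V₁` have positive weight, as the members of `E₁` are incomparable.
  have hpos : ∀ v ∈ V₁, 0 < w₁ v := by
    intro v hv
    obtain ⟨e, he, hve⟩ := Finset.mem_sup.1 hv
    change v ∈ e at hve
    have h3 : ¬ ∑ x ∈ e, w₁ x ≤ t₁ := fun h => (h₁ e).1 h e he subset_rfl
    have h4 : ∑ x ∈ e.erase v, w₁ x ≤ t₁ := (h₁ _).2 fun f hf hfe => by
      have hfe' : f ⊆ e := hfe.trans (Finset.erase_subset _ _)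
      have hne : f ≠ e := fun h => Finset.notMem_erase v e (hfe (h ▸ hve))
      have := hS₁ f hf e he hne
      rw [Finset.sdiff_eq_empty_iff_subset.2 hfe'] at this
      simp at this
    have := Finset.add_sum_erase e w₁ hve
    omega
  set W₁ := ∑ x ∈ V₁, w₁ x with hW₁
  set W₂ := ∑ x, w₂ x with hW₂
  have hW₂0 : 0 ≤ W₂ := Finset.sum_nonneg fun x _ => hw₂ x
  have ht₁ : t₁ + 1 ≤ W₁ := by
    by_contra h
    exact (h₁ V₁).1 (by omega) _ (hmem₁ hg₀ hzg₀) (hsubV₁ _ (hmem₁ hg₀ hzg₀))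
  -- `M` exceeds `W₂` and `W₂ - t₂`, so that one unit of `w₁` outweighs every change in `w₂`. The
  -- weight `c` of `z` lets a set without an edge of `E₁` just reach the threshold, in the worst case
  -- of weight `t₁` on `V₁` and `W₂` elsewhere.
  set M := |t₂| + W₂ + 1 with hM
  have hM0 : 0 ≤ M := by positivity
  have habs1 := le_abs_self t₂
  have habs2 := neg_abs_le t₂
  set c := M * (W₁ - t₁) + t₂ - W₂ with hc
  have hMt : M * 1 ≤ M * (W₁ - t₁) := mul_le_mul_of_nonneg_left (by omega) hM0
  have hc0 : 0 ≤ c := by omega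
  refine ⟨fun v => if v = z then c else if v ∈ V₁ then M * w₁ v else w₂ v, M * W₁ + t₂,
    fun v => ?_, fun X => ?_⟩
  · dsimp only
    split_ifs
    · exact hc0
    · exact mul_nonneg hM0 (hw₁ v)
    · exact hw₂ v
  set X₁ := X ∩ V₁ with hX₁
  set X₂ := X.erase z \ V₁ with hX₂
  set s₁ := ∑ x ∈ X₁, w₁ x with hs₁
  set s₂ := ∑ x ∈ X₂, w₂ x with hs₂
  have hs₂W : s₂ ≤ W₂ := Finset.sum_le_univ_sum_of_nonneg hw₂
  have hs₂0 : 0 ≤ s₂ := Finset.sum_nonneg fun x _ => hw₂ x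
  have hs₁W : V₁ ⊆ X ∧ s₁ = W₁ ∨ ¬ V₁ ⊆ X ∧ s₁ + 1 ≤ W₁ := by
    by_cases h : V₁ ⊆ X
    · exact .inl ⟨h, by rw [hs₁, hX₁, Finset.inter_eq_right.2 h]⟩
    · refine .inr ⟨h, Int.add_one_le_of_lt ?_⟩
      obtain ⟨v, hv, hvX⟩ := Finset.not_subset.1 h
      exact Finset.sum_lt_sum_of_subset Finset.inter_subset_right hv
        (fun h => hvX (Finset.mem_inter.1 h).1) (hpos v hv) fun x _ _ => hw₁ x
  have hsum : (∑ x ∈ X, if x = z then c else if x ∈ V₁ then M * w₁ x else w₂ x) =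
      (if z ∈ X then c else 0) + M * s₁ + s₂ := by
    rw [Finset.sum_ite, Finset.sum_ite, Finset.mul_sum, ← add_assoc]
    congr 1
    · congr 1
      · rw [Finset.filter_eq']
        split_ifs <;> simp
      · refine Finset.sum_congr ?_ fun _ _ => rfl
        ext v
        simp only [Finset.mem_filter, hX₁, Finset.mem_inter]
        grind
    · refine Finset.sum_congr ?_ fun _ _ => rfl
      ext v
      simp only [Finset.mem_filter, hX₂, Finset.mem_sdiff, Finset.mem_erase]
      tauto
  have hcontains : (∀ e ∈ E, ¬ e ⊆ X) ↔
      (z ∈ X → ∀ e ∈ E₁, ¬ e ⊆ X₁) ∧ (V₁ ⊆ X → ∀ e ∈ E₂, ¬ e ⊆ X₂) := by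
    constructor
    · refine fun h => ⟨fun hzX e he heX => ?_, fun hVX e he heX => ?_⟩
      · obtain ⟨e, he', rfl⟩ := Finset.mem_image.1 he
        obtain ⟨he', hze⟩ := Finset.mem_filter.1 he'
        refine h e he' fun v hv => ?_
        rcases eq_or_ne v z with rfl | hvz
        · exact hzX
        · exact (Finset.mem_inter.1 (heX (Finset.mem_erase.2 ⟨hvz, hv⟩))).1
      · obtain ⟨e, he', rfl⟩ := Finset.mem_image.1 he
        obtain ⟨he', hze⟩ := Finset.mem_filter.1 he'
        refine h e he' fun v hv => ?_
        by_cases hvV : v ∈ V₁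
        · exact hVX hvV
        · exact Finset.mem_of_mem_erase
            (Finset.mem_sdiff.1 (heX (Finset.mem_sdiff.2 ⟨hv, hvV⟩))).1
    · rintro ⟨h1, h2⟩ e he heX
      by_cases hze : z ∈ e
      · exact h1 (heX hze) _ (hmem₁ he hze) (Finset.subset_inter
          ((Finset.erase_subset _ _).trans heX) (hsubV₁ _ (hmem₁ he hze)))
      · refine h2 ((hV₁sub e he hze).trans heX) _ (hmem₂ he hze) fun v hv => ?_
        obtain ⟨hve, hvV⟩ := Finset.mem_sdiff.1 hv
        exact Finset.mem_sdiff.2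
          ⟨Finset.mem_erase.2 ⟨fun h => hze (h ▸ hve), heX hve⟩, hvV⟩
  rw [hsum, hcontains, ← h₁, ← h₂]
  have hMs : M * (s₁ + 1) ≤ M * W₁ ∨ s₁ = W₁ := by
    rcases hs₁W with h | h
    · exact .inr h.2
    · exact .inl (mul_le_mul_of_nonneg_left h.2 hM0)
  have hMt' : s₁ ≤ t₁ ∧ M * s₁ ≤ M * t₁ ∨ t₁ + 1 ≤ s₁ ∧ M * (t₁ + 1) ≤ M * s₁ := by
    rcases le_or_gt s₁ t₁ with h | h
    · exact .inl ⟨h, mul_le_mul_of_nonneg_left h hM0⟩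
    · exact .inr ⟨h, mul_le_mul_of_nonneg_left (Int.add_one_le_of_lt h) hM0⟩
  have hcM : c = M * W₁ - M * t₁ + t₂ - W₂ := by rw [hc]; ring
  rw [mul_add, mul_one] at hMs hMt'
  by_cases hzX : z ∈ X
  · simp only [hzX, if_true, forall_const]
    rcases hMt' with ⟨h3, h4⟩ | ⟨h3, h4⟩
    · refine iff_of_true (by omega) ⟨h3, fun hVX => ?_⟩
      rcases hs₁W with h | h
      · omega
      · exact absurd hVX h.1
    · exact iff_of_false (by omega) fun h => by omega
  · simp only [hzX, if_false, false_imp_iff, true_and, zero_add]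
    rcases hs₁W with ⟨h5, h6⟩ | ⟨h5, h6⟩
    · rw [h6]
      simp only [h5, forall_const]
      omega
    · refine iff_of_true ?_ fun h => absurd h h5
      rcases hMs with h | h <;> omega

end OneSperner

theorem Hypergraph.IsOneSperner.isThreshold {α : Type*} [Finite α] {H : Hypergraph α}
    (hH : H.IsOneSperner) : H.IsThreshold := by
  classical
  have := Fintype.ofFinite α
  have hE : IsOneSpernerFamily {e : Finset α | (e : Set α) ∈ H.edgeSet} := by
    intro e he f hf hef
    rw [Finset.mem_filter] at he hf
    have h := hH _ he.2 _ hf.2 fun h => hef (Finset.coe_injective h)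
    rwa [← Finset.coe_sdiff, ← Finset.coe_sdiff, Set.ncard_coe_finset, Set.ncard_coe_finset] at h
  obtain ⟨w, t, hw, h⟩ := hE.exists_weights
  refine ⟨fun v => w v, t, fun v => Int.cast_nonneg (hw v), fun X _ => ?_⟩
  rw [finsum_mem_eq_finite_toFinset_sum _ X.toFinite, ← Int.cast_sum, Int.cast_le, h]
  constructor
  · rintro h ⟨e, he, heX⟩
    refine h e.toFinset (by simpa using he) fun v hv => ?_
    simpa using heX (by simpa using hv)
  · rintro h e he heX
    refine h ⟨e, (Finset.mem_filter.1 he).2, fun v hv => ?_⟩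
    simpa using heX hv

/-! ### The forbidden induced subgraphs are 2-summable -/

namespace SimpleGraph

variable {V : Type*} {G : SimpleGraph V}

lemma isCutset_of_closed {A K : Set V} {u v : V} (huA : u ∉ A) (hvA : v ∉ A) (hu : u ∈ K)
    (hv : v ∉ K) (hK : ∀ y z, y ∈ K → z ∉ K → y ∉ A → z ∉ A → ¬ G.Adj y z) : G.IsCutset A := by
  refine isCutset_iff.2 ⟨u, huA, v, hvA, fun h => ?_⟩
  obtain ⟨y, z, hy, hz, hyA, hzA, hyz⟩ := h.exists_exit hu hv
  exact hK y z hy hz hyA hzA hyz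

/-- A set is connected if each of its vertices other than `r` has a neighbour of smaller rank
in the set. -/
lemma isConnDominating_of_rank {S : Set V} {r : V} (ρ : V → ℕ) (hr : r ∈ S)
    (hdom : ∀ v, v ∉ S → ∃ u ∈ S, G.Adj v u)
    (h : ∀ v ∈ S, v ≠ r → ∃ u ∈ S, G.Adj v u ∧ ρ u < ρ v) : G.IsConnDominating S := by
  have key : ∀ n, ∀ v ∈ S, ρ v = n → G.JoinedWithin S v r := by
    intro n
    induction n using Nat.strong_induction_on with
    | _ n ih =>
    rintro v hv rfl
    rcases eq_or_ne v r with rfl | hvr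
    · exact .refl hv
    · obtain ⟨u, hu, hvu, hlt⟩ := h v hv hvr
      exact (hvu.joinedWithin hv hu).trans (ih _ hlt u hu rfl)
  refine ⟨fun v => or_iff_not_imp_left.2 (hdom v), induce_connected_iff.2 ⟨⟨r, hr⟩, ?_⟩⟩
  exact fun u hu v hv => (key _ u hu rfl).trans (key _ v hv rfl).symm

lemma IsCutset.image {V' : Type*} {G' : SimpleGraph V'} (φ : G ≃g G') {A : Set V}
    (hA : G.IsCutset A) : G'.IsCutset (φ '' A) := by
  obtain ⟨u, hu, v, hv, huv⟩ := isCutset_iff.1 hA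
  refine isCutset_iff.2 ⟨φ u, by simpa using hu, φ v, by simpa using hv, fun h => huv ?_⟩
  have h' := h.map φ.symm.toRelEmbedding.toRelHom
  convert h' using 1
  · ext x
    constructor
    · exact fun hx => ⟨φ x, by simpa using hx, φ.symm_apply_apply x⟩
    · rintro ⟨y, hy, rfl⟩ hx
      exact hy ⟨_, hx, φ.apply_symm_apply y⟩
  · exact (φ.symm_apply_apply u).symm
  · exact (φ.symm_apply_apply v).symm

lemma IsConnDominating.image {V' : Type*} {G' : SimpleGraph V'} (φ : G ≃g G') {S : Set V}
    (hS : G.IsConnDominating S) : G'.IsConnDominating (φ '' S) := by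
  refine ⟨fun v => ?_, ?_⟩
  · obtain ⟨v, rfl⟩ := φ.surjective v
    rcases hS.1 v with h | ⟨u, hu, hvu⟩
    · exact .inl ⟨v, h, rfl⟩
    · exact .inr ⟨φ u, ⟨u, hu, rfl⟩, φ.map_adj_iff.2 hvu⟩
  · obtain ⟨hne, h⟩ := induce_connected_iff.1 hS.2
    refine induce_connected_iff.2 ⟨hne.image _, ?_⟩
    rintro _ ⟨u, hu, rfl⟩ _ ⟨v, hv, rfl⟩
    exact (h u hu v hv).map φ.toRelEmbedding.toRelHom

/-- Two cutsets `A₁, A₂` and two sets `B₁, B₂` with connected dominating complements, covering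
every vertex equally often, witness that the cutset hypergraph is 2-summable. -/
lemma isSummable_cutsetHypergraph [Finite V] {A₁ A₂ B₁ B₂ : Set V} (hA₁ : G.IsCutset A₁)
    (hA₂ : G.IsCutset A₂) (hB₁ : G.IsConnDominating B₁ᶜ) (hB₂ : G.IsConnDominating B₂ᶜ)
    (hunion : A₁ ∪ A₂ = B₁ ∪ B₂) (hinter : A₁ ∩ A₂ = B₁ ∩ B₂) :
    G.cutsetHypergraph.IsSummable 2 := by
  classical
  refine ⟨2, le_rfl, le_rfl, ![A₁, A₂], ![B₁, B₂], ?_, ?_, fun v _ => ?_⟩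
  · rw [Fin.forall_fin_two]
    exact ⟨⟨Set.subset_univ _, containsEdge_cutsetHypergraph_iff.2 ⟨_, subset_rfl, hA₁⟩⟩,
      ⟨Set.subset_univ _, containsEdge_cutsetHypergraph_iff.2 ⟨_, subset_rfl, hA₂⟩⟩⟩
  · rw [Fin.forall_fin_two]
    refine ⟨⟨Set.subset_univ _, ?_⟩, ⟨Set.subset_univ _, ?_⟩⟩
    · simpa using hB₁.not_containsEdge_compl
    · simpa using hB₂.not_containsEdge_compl
  · have key : ∀ C D : Set V, {i | v ∈ (![C, D] : Fin 2 → Set V) i}.ncard =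
        (if v ∈ C ∪ D then 1 else 0) + if v ∈ C ∩ D then 1 else 0 := by
      intro C D
      rw [Set.ncard_eq_toFinset_card', Set.toFinset_ofPred, Finset.card_filter, Fin.sum_univ_two]
      by_cases h1 : v ∈ C <;> by_cases h2 : v ∈ D <;> simp [h1, h2]
    simp only [key, hunion, hinter]

lemma exists_not_isAsummable [Finite V] {V' : Type*} {F : SimpleGraph V'} (hF : F.IsIndContained G)
    {A₁ A₂ B₁ B₂ : Set V'} (hA₁ : F.IsCutset A₁) (hA₂ : F.IsCutset A₂)
    (hB₁ : F.IsConnDominating B₁ᶜ) (hB₂ : F.IsConnDominating B₂ᶜ)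
    (hunion : A₁ ∪ A₂ = B₁ ∪ B₂) (hinter : A₁ ∩ A₂ = B₁ ∩ B₂) :
    ∃ U : Set V, ¬ (G.induce U).cutsetHypergraph.IsAsummable 2 := by
  obtain ⟨f⟩ := hF
  let φ : F ≃g G.induce (Set.range f) :=
    { toEquiv := Equiv.ofInjective f f.injective
      map_rel_iff' := f.map_rel_iff }
  have hc : ∀ B : Set V', (φ '' B)ᶜ = φ '' Bᶜ := fun B =>
    (Set.image_compl_eq φ.bijective).symm
  refine ⟨Set.range f, not_not.2 (isSummable_cutsetHypergraph (hA₁.image φ) (hA₂.image φ)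
    (B₁ := φ '' B₁) (B₂ := φ '' B₂) ?_ ?_ ?_ ?_)⟩
  · rw [hc]; exact hB₁.image φ
  · rw [hc]; exact hB₂.image φ
  · rw [← Set.image_union, ← Set.image_union, hunion]
  · rw [← Set.image_inter φ.injective, ← Set.image_inter φ.injective, hinter]

lemma cycleGraph_adj_iff_val {n : ℕ} (hn : 2 ≤ n) {i j : Fin n} :
    (cycleGraph n).Adj i j ↔ i.val + 1 = j.val ∨ j.val + 1 = i.val ∨
      (i.val = 0 ∧ j.val + 1 = n) ∨ (j.val = 0 ∧ i.val + 1 = n) := by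
  rw [cycleGraph_adj']
  have h := i.2
  have h' := j.2
  rcases lt_trichotomy i j with hij | rfl | hij
  · rw [Fin.coe_sub_iff_lt.2 hij, Fin.coe_sub_iff_le.2 hij.le]
    have : i.val < j.val := hij
    omega
  · have : (i - i).val = 0 := by rw [Fin.coe_sub_iff_le.2 le_rfl]; omega
    omega
  · rw [Fin.coe_sub_iff_lt.2 hij, Fin.coe_sub_iff_le.2 hij.le]
    have : j.val < i.val := hij
    omega

lemma exists_not_isAsummable_of_cycleGraph [Finite V] {k : ℕ} (hk : 4 ≤ k)
    (h : (cycleGraph k).IsIndContained G) :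
    ∃ U : Set V, ¬ (G.induce U).cutsetHypergraph.IsAsummable 2 := by
  have hadj := fun i j : Fin k => cycleGraph_adj_iff_val (by omega : 2 ≤ k) (i := i) (j := j)
  refine exists_not_isAsummable h (A₁ := {i | i.val = 0 ∨ i.val = 2})
    (A₂ := {i | i.val = 1 ∨ i.val = 3}) (B₁ := {i | i.val = 0 ∨ i.val = 1})
    (B₂ := {i | i.val = 2 ∨ i.val = 3}) ?_ ?_ ?_ ?_ ?_ ?_
  · refine isCutset_of_closed (K := {⟨1, by omega⟩}) (u := ⟨1, by omega⟩) (v := ⟨3, by omega⟩)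
      (by simp) (by simp) rfl (by simp [Fin.ext_iff]) fun y z hy hz _ hzA => ?_
    have hy' : y.val = 1 := by rw [Set.mem_singleton_iff.1 hy]
    simp only [Set.mem_ofPred_eq, not_or] at hzA
    rw [hadj]; omega
  · refine isCutset_of_closed (K := {⟨2, by omega⟩}) (u := ⟨2, by omega⟩) (v := ⟨0, by omega⟩)
      (by simp) (by simp) rfl (by simp [Fin.ext_iff]) fun y z hy hz _ hzA => ?_
    have hy' : y.val = 2 := by rw [Set.mem_singleton_iff.1 hy]
    simp only [Set.mem_ofPred_eq, not_or] at hzA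
    rw [hadj]; omega
  · refine isConnDominating_of_rank (r := ⟨2, by omega⟩) (fun i => i.val) (by simp) ?_ ?_
    · intro v hv
      simp only [Set.mem_compl_iff, Set.mem_ofPred_eq, not_not] at hv
      rcases hv with hv | hv
      · exact ⟨⟨k - 1, by omega⟩, by simp; omega, by rw [hadj]; simp; omega⟩
      · exact ⟨⟨2, by omega⟩, by simp, by rw [hadj]; simp; omega⟩
    · intro v hv hvr
      simp only [Set.mem_compl_iff, Set.mem_ofPred_eq, not_or] at hv
      have : v.val ≠ 2 := fun h => hvr (Fin.ext h)
      exact ⟨⟨v.val - 1, by omega⟩, by simp; omega, by rw [hadj]; simp; omega, by simp; omega⟩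
  · refine isConnDominating_of_rank (r := ⟨1, by omega⟩)
      (fun i => if i.val ≤ 1 then 1 - i.val else k + 1 - i.val) (by simp) ?_ ?_
    · intro v hv
      simp only [Set.mem_compl_iff, Set.mem_ofPred_eq, not_not] at hv
      rcases hv with hv | hv
      · exact ⟨⟨1, by omega⟩, by simp, by rw [hadj]; simp; omega⟩
      · rcases eq_or_lt_of_le hk with rfl | hk
        · exact ⟨0, by simp, by rw [hadj]; simp; omega⟩
        · exact ⟨⟨4, by omega⟩, by simp, by rw [hadj]; simp; omega⟩
    · intro v hv hvr
      simp only [Set.mem_compl_iff, Set.mem_ofPred_eq, not_or] at hv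
      have hv1 : v.val ≠ 1 := fun h => hvr (Fin.ext h)
      by_cases hv0 : v.val = 0
      · refine ⟨⟨1, by omega⟩, by simp, by rw [hadj]; simp; omega, by simp [hv0]⟩
      by_cases hvk : v.val + 1 = k
      · refine ⟨⟨0, by omega⟩, by simp, by rw [hadj]; simp; omega, ?_⟩
        dsimp only
        split_ifs <;> omega
      · refine ⟨⟨v.val + 1, by omega⟩, by simp; omega, by rw [hadj]; simp, ?_⟩
        dsimp only
        split_ifs <;> omega
  · ext i
    simp only [Set.mem_union, Set.mem_ofPred_eq]
    omega
  · ext i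
    simp only [Set.mem_inter_iff, Set.mem_ofPred_eq]
    omega

/-- In `F₁` and in `F₂` the cutsets `{1, 2}` and `{3, 4}` can be exchanged for `{1, 3}` and
`{2, 4}`. -/
lemma exists_not_isAsummable_of_fin_six [Finite V] {F : SimpleGraph (Fin 6)}
    (h : F.IsIndContained G)
    (h1 : ∀ z, z ≠ 0 → z ≠ 1 → z ≠ 2 → ¬ F.Adj 0 z) (h2 : ∀ z, z ≠ 5 → z ≠ 4 → z ≠ 3 → ¬ F.Adj 5 z)
    (h01 : F.Adj 0 1) (h02 : F.Adj 0 2) (h13 : F.Adj 1 3) (h24 : F.Adj 2 4) (h35 : F.Adj 3 5)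
    (h45 : F.Adj 4 5) : ∃ U : Set V, ¬ (G.induce U).cutsetHypergraph.IsAsummable 2 := by
  refine exists_not_isAsummable h (A₁ := {1, 2}) (A₂ := {3, 4}) (B₁ := {1, 3}) (B₂ := {2, 4})
    ?_ ?_ ?_ ?_ ?_ ?_
  · refine isCutset_of_closed (K := {0}) (u := 0) (v := 5) (by simp) (by simp) rfl (by simp) ?_
    rintro _ z rfl hz - hzA
    exact h1 z hz (fun h => hzA (.inl h)) fun h => hzA (.inr h)
  · refine isCutset_of_closed (K := {5}) (u := 5) (v := 0) (by simp) (by simp) rfl (by simp) ?_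
    rintro _ z rfl hz - hzA
    exact h2 z hz (fun h => hzA (.inr h)) fun h => hzA (.inl h)
  · refine isConnDominating_of_rank (r := 0) (fun i => i.val) (by simp) ?_ ?_
    · intro v hv
      fin_cases v
      all_goals first
        | exact ⟨0, by simp, h01.symm⟩
        | exact ⟨5, by simp, h35⟩
        | simp at hv
    · intro v hv hv0
      fin_cases v
      all_goals first
        | exact ⟨0, by simp, h02.symm, by simp⟩
        | exact ⟨2, by simp, h24.symm, by simp⟩
        | exact ⟨4, by simp, h45.symm, by simp⟩
        | simp at hv hv0
  · refine isConnDominating_of_rank (r := 0) (fun i => i.val) (by simp) ?_ ?_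
    · intro v hv
      fin_cases v
      all_goals first
        | exact ⟨0, by simp, h02.symm⟩
        | exact ⟨5, by simp, h45⟩
        | simp at hv
    · intro v hv hv0
      fin_cases v
      all_goals first
        | exact ⟨0, by simp, h01.symm, by simp⟩
        | exact ⟨1, by simp, h13.symm, by simp⟩
        | exact ⟨3, by simp, h35.symm, by simp⟩
        | simp at hv hv0
  · ext i; fin_cases i <;> simp
  · ext i; fin_cases i <;> simp

instance : DecidableRel graphF1.Adj := by unfold graphF1; infer_instance

instance : DecidableRel graphF2.Adj := by unfold graphF2; infer_instance

lemma exists_not_isAsummable_of_graphF1 [Finite V] (h : graphF1.IsIndContained G) :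
    ∃ U : Set V, ¬ (G.induce U).cutsetHypergraph.IsAsummable 2 := by
  refine exists_not_isAsummable_of_fin_six h ?_ ?_ ?_ ?_ ?_ ?_ ?_ ?_ <;> decide

lemma exists_not_isAsummable_of_graphF2 [Finite V] (h : graphF2.IsIndContained G) :
    ∃ U : Set V, ¬ (G.induce U).cutsetHypergraph.IsAsummable 2 := by
  refine exists_not_isAsummable_of_fin_six h ?_ ?_ ?_ ?_ ?_ ?_ ?_ ?_ <;> decide

/-- In `Hₙ` the two cutsets `{x₂, x₃}` and `{z₂, z₃}` can be exchanged for the sets `{x₂, z₂}` and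
`{x₃, z₃}`, whose complements contain a dominating path. -/
lemma exists_not_isAsummable_of_graphH [Finite V] {n : ℕ} (hn : 1 ≤ n)
    (h : (graphH n).IsIndContained G) :
    ∃ U : Set V, ¬ (G.induce U).cutsetHypergraph.IsAsummable 2 := by
  have hB : ∀ a b : Fin 3, (a = 1 ∧ b = 2 ∨ a = 2 ∧ b = 1) →
      (graphH n).IsConnDominating {Sum.inl a, Sum.inr (Sum.inr a)}ᶜ := by
    intro a b hab
    have ha0 : a ≠ 0 := by omega
    have hb0 : b ≠ 0 := by omega
    have hba : b ≠ a := by omega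
    have h3 : ∀ c : Fin 3, c ≠ a → c ≠ 0 → c = b := by intro c; omega
    refine isConnDominating_of_rank (r := .inl 0) (fun v => match v with
      | .inl c => if c = 0 then 0 else 1
      | .inr (.inl i) => i.val + 2
      | .inr (.inr c) => if c = 0 then n + 3 else n + 2) (by simp [ha0.symm]) ?_ ?_
    · intro v hv
      simp only [Set.mem_compl_iff, not_not, Set.mem_insert_iff, Set.mem_singleton_iff] at hv
      rcases hv with rfl | rfl
      · exact ⟨.inl 0, by simp [ha0.symm], by simp [graphH, graphHRel, ha0]⟩
      · exact ⟨.inr (.inr 0), by simp [ha0.symm], by simp [graphH, graphHRel, ha0]⟩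
    · rintro (c | i | c) hv hv0
      · have hc0 : c ≠ 0 := fun h => hv0 (h ▸ rfl)
        exact ⟨.inl 0, by simp [ha0.symm], by simp [graphH, graphHRel, hc0], by simp [hc0]⟩
      · rcases Nat.eq_zero_or_pos i.val with hi | hi
        · exact ⟨.inl b, by simp [hba], by simp [graphH, graphHRel, hb0, hi], by simp [hb0]⟩
        · refine ⟨.inr (.inl ⟨i.val - 1, by omega⟩), by simp, ?_, by simp; omega⟩
          simp [graphH, graphHRel, Fin.ext_iff]
          omega
      · by_cases hc0 : c = 0
        · subst hc0
          exact ⟨.inr (.inr b), by simp [hba], by simp [graphH, graphHRel, hb0.symm],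
            by simp [hb0]⟩
        · refine ⟨.inr (.inl ⟨n - 1, by omega⟩), by simp, ?_, by simp [hc0]; omega⟩
          simp [graphH, graphHRel, hc0]
          omega
  refine exists_not_isAsummable h (A₁ := {.inl 1, .inl 2})
    (A₂ := {.inr (.inr 1), .inr (.inr 2)}) ?_ ?_ (hB 1 2 (by simp)) (hB 2 1 (by simp)) ?_ ?_
  · refine isCutset_of_closed (K := {.inl 0}) (u := .inl 0) (v := .inr (.inr 0)) (by simp)
      (by simp) rfl (by simp) ?_
    rintro _ (c | i | c) rfl hz - hzA
    · fin_cases c <;> simp at hz hzA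
    · simp [graphH, graphHRel]
    · simp [graphH, graphHRel]
  · refine isCutset_of_closed (K := {.inr (.inr 0)}) (u := .inr (.inr 0)) (v := .inl 0) (by simp)
      (by simp) rfl (by simp) ?_
    rintro _ (c | i | c) rfl hz - hzA
    · simp [graphH, graphHRel]
    · simp [graphH, graphHRel]
    · fin_cases c <;> simp at hz hzA
  · ext v
    simp only [Set.mem_union, Set.mem_insert_iff, Set.mem_singleton_iff]
    tauto
  · ext v
    simp only [Set.mem_inter_iff, Set.mem_insert_iff, Set.mem_singleton_iff]
    rcases v with c | i | c
    · simp; omega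
    · simp
    · simp; omega

end SimpleGraph

/-! ### Chordless paths and induced cycles -/

namespace SimpleGraph

variable {V : Type*} {G : SimpleGraph V} {K K' : Set V} {a b u v : V} {l : ℕ} {p : ℕ → V}

/-- `p 0, …, p l` is a walk of length `l ≥ 2` from `a` to `b` whose inner vertices lie in `K`.
The values of `p` beyond `l` are irrelevant. -/
structure IsConnectingSeq (G : SimpleGraph V) (K : Set V) (a b : V) (l : ℕ) (p : ℕ → V) :
    Prop where
  two_le : 2 ≤ l
  zero : p 0 = a
  last : p l = b
  mem : ∀ i, 0 < i → i < l → p i ∈ K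
  adj : ∀ i, i < l → G.Adj (p i) (p (i + 1))

lemma JoinedWithin.exists_isConnectingSeq (h : G.JoinedWithin K u v) (hau : G.Adj a u)
    (hbv : G.Adj b v) : ∃ l p, G.IsConnectingSeq K a b l p := by
  obtain ⟨w, hw⟩ := h
  refine ⟨w.length + 2, fun i => if i = 0 then a else if i ≤ w.length + 1 then w.getVert (i - 1)
    else b, ⟨by omega, by simp, by simp, fun i hi hil => ?_, fun i hi => ?_⟩⟩
  · rw [if_neg (by omega), if_pos (by omega)]
    exact hw _ (w.getVert_mem_support _)
  · rw [if_neg (by omega : ¬ i + 1 = 0)]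
    split_ifs with h0 h1 h2 h2
    · simpa [h0] using hau
    · omega
    · have := w.adj_getVert_succ (i := i - 1) (by omega)
      rwa [Nat.sub_add_cancel (by omega)] at this
    · have : i - 1 = w.length := by omega
      rw [this, Walk.getVert_length]
      exact hbv.symm
    · omega
    · omega

/-- A shortest walk between `a` and `b` with inner vertices in `K` has no chord, except possibly
the edge `ab`. -/
lemma exists_chordless (h : ∃ l p, G.IsConnectingSeq K a b l p) :
    ∃ l p, G.IsConnectingSeq K a b l p ∧
      ∀ i j, i + 1 < j → j ≤ l → (i = 0 → j ≠ l) → ¬ G.Adj (p i) (p j) := by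
  classical
  have hmin := fun m => Nat.find_min h (m := m)
  obtain ⟨p, hp⟩ := Nat.find_spec h
  set l := Nat.find h
  refine ⟨l, p, hp, fun i j hij hjl h0 hadj => hmin (l - (j - i - 1)) (by omega) ?_⟩
  -- A chord from `p i` to `p j` is a shortcut; it keeps length at least 2 unless it joins the ends.
  refine ⟨fun k => if k ≤ i then p k else p (k + (j - i - 1)), ⟨by omega, by simpa using hp.zero,
    ?_, fun k hk hkl => ?_, fun k hk => ?_⟩⟩
  · rw [if_neg (by omega), Nat.sub_add_cancel (by omega)]
    exact hp.last
  · split_ifs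
    · exact hp.mem k hk (by omega)
    · exact hp.mem _ (by omega) (by omega)
  · split_ifs with h1 h2 h2
    · exact hp.adj k (by omega)
    · obtain rfl : k = i := by omega
      rwa [show k + 1 + (j - k - 1) = j by omega]
    · omega
    · rw [show k + 1 + (j - i - 1) = k + (j - i - 1) + 1 by omega]
      exact hp.adj _ (by omega)

lemma IsConnectingSeq.injective_of_chordless (hp : G.IsConnectingSeq K a b l p)
    (hc : ∀ i j, i + 1 < j → j ≤ l → (i = 0 → j ≠ l) → ¬ G.Adj (p i) (p j)) (hab : a ≠ b)
    (hK : ¬ G.Adj a b ∨ a ∉ K ∧ b ∉ K) {i j : ℕ} (hij : i < j) (hjl : j ≤ l) : p i ≠ p j := by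
  have hl := hp.two_le
  intro h
  rcases Nat.eq_zero_or_pos i with rfl | hi
  · rcases eq_or_lt_of_le hjl with rfl | hjl
    · exact hab (hp.zero ▸ hp.last ▸ h)
    · rcases hK with hK | hK
      · have hadj := hp.adj j hjl
        rw [← h] at hadj
        by_cases hj : j + 1 = l
        · rw [hj, hp.zero, hp.last] at hadj
          exact hK hadj
        · exact hc 0 (j + 1) (by omega) (by omega) (fun _ => hj) hadj
      · exact hK.1 (hp.zero ▸ h ▸ hp.mem j hij hjl)
  · rcases eq_or_lt_of_le hjl with rfl | hjl
    · rcases hK with hK | hK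
      · have hadj := hp.adj (i - 1) (by omega)
        rw [Nat.sub_add_cancel hi, h] at hadj
        by_cases hi1 : i = 1
        · subst hi1
          rw [hp.last] at hadj
          exact hK (by simpa [hp.zero] using hadj)
        · exact hc (i - 1) j (by omega) le_rfl (by omega) hadj
      · exact hK.2 (hp.last ▸ h ▸ hp.mem i hi hij)
    · have hadj := hp.adj j hjl
      rw [← h] at hadj
      exact hc i (j + 1) (by omega) (by omega) (by omega) hadj

lemma IsConnectingSeq.adj_iff_of_chordless (hp : G.IsConnectingSeq K a b l p)
    (hc : ∀ i j, i + 1 < j → j ≤ l → (i = 0 → j ≠ l) → ¬ G.Adj (p i) (p j))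
    {i j : ℕ} (hij : i < j) (hjl : j ≤ l) :
    G.Adj (p i) (p j) ↔ j = i + 1 ∨ (i = 0 ∧ j = l ∧ G.Adj a b) := by
  have hl := hp.two_le
  constructor
  · intro h
    by_contra hcon
    refine hc i j (by omega) hjl ?_ h
    rintro rfl rfl
    rw [hp.zero, hp.last] at h
    exact hcon (.inr ⟨rfl, rfl, h⟩)
  · rintro (rfl | ⟨rfl, rfl, h⟩)
    · exact hp.adj i (by omega)
    · rwa [hp.zero, hp.last]

lemma cycleGraph_isIndContained {n : ℕ} (hn : 2 ≤ n) (f : ℕ → V)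
    (hinj : ∀ i j, i < j → j < n → f i ≠ f j)
    (hadj : ∀ i j, i < j → j < n → (G.Adj (f i) (f j) ↔ j = i + 1 ∨ (i = 0 ∧ j + 1 = n))) :
    (cycleGraph n).IsIndContained G := by
  refine ⟨⟨⟨fun i => f i, fun i j hij => ?_⟩, fun {i j} => ?_⟩⟩
  · rcases lt_trichotomy i j with h | h | h
    · exact absurd hij (hinj i j h j.2)
    · exact h
    · exact absurd hij.symm (hinj j i h i.2)
  · rw [cycleGraph_adj_iff_val hn]
    change G.Adj (f i) (f j) ↔ _
    have hi := i.2
    have hj := j.2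
    rcases lt_trichotomy i j with h | rfl | h
    · rw [hadj i j h j.2]
      have : i.val < j.val := h
      omega
    · simp; omega
    · rw [G.adj_comm, hadj j i h i.2]
      have : j.val < i.val := h
      omega

/-- In a chordal graph the two ends of an edge that both have a neighbour in a connected set
have a common neighbour there. -/
lemma IsChordal.exists_common_neighbor (hG : G.IsChordal) (hab : G.Adj a b) (haK : a ∉ K)
    (hbK : b ∉ K) (h : G.JoinedWithin K u v) (hau : G.Adj a u) (hbv : G.Adj b v) :
    ∃ x ∈ K, G.Adj x a ∧ G.Adj x b := by
  obtain ⟨l, p, hp, hc⟩ := exists_chordless (h.exists_isConnectingSeq hau hbv)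
  -- A chordless path with inner vertices in `K` closes up to an induced cycle with the edge `ab`,
  -- so it has length 2.
  rcases eq_or_lt_of_le hp.two_le with rfl | hl
  · refine ⟨p 1, hp.mem 1 (by omega) (by omega), ?_, ?_⟩
    · simpa [hp.zero] using (hp.adj 0 (by omega)).symm
    · simpa [hp.last] using hp.adj 1 (by omega)
  · refine absurd ?_ (hG (l + 1) (by omega))
    refine cycleGraph_isIndContained (by omega) p (fun i j hij hj => ?_) fun i j hij hj => ?_
    · exact hp.injective_of_chordless hc hab.ne (.inr ⟨haK, hbK⟩) hij (by omega)
    · rw [hp.adj_iff_of_chordless hc hij (by omega)]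
      simp [hab]

/-- In a chordal graph two vertices are adjacent if both have neighbours in each of two connected
sets with no edge between them: otherwise chordless paths through the two sets form an induced
cycle. -/
lemma IsChordal.adj_of_two_sides (hG : G.IsChordal) (hab : a ≠ b)
    (hKK' : ∀ x ∈ K, ∀ y ∈ K', x ≠ y ∧ ¬ G.Adj x y) {u' v' : V}
    (h : G.JoinedWithin K u v) (hau : G.Adj a u) (hbv : G.Adj b v)
    (h' : G.JoinedWithin K' u' v') (hau' : G.Adj a u') (hbv' : G.Adj b v') : G.Adj a b := by
  by_contra hnab
  obtain ⟨l, p, hp, hc⟩ := exists_chordless (h.exists_isConnectingSeq hau hbv)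
  obtain ⟨m, q, hq, hc'⟩ := exists_chordless (h'.exists_isConnectingSeq hau' hbv')
  have hl := hp.two_le
  have hm := hq.two_le
  have hpi := fun i j => hp.injective_of_chordless hc hab (.inl hnab) (i := i) (j := j)
  have hqi := fun i j => hq.injective_of_chordless hc' hab (.inl hnab) (i := i) (j := j)
  have hpa := fun i j => hp.adj_iff_of_chordless hc (i := i) (j := j)
  have hqa := fun i j => hq.adj_iff_of_chordless hc' (i := i) (j := j)
  simp only [hnab, and_false, or_false] at hpa hqa
  refine hG (l + m) (by omega) (cycleGraph_isIndContained (by omega)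
    (fun i => if i ≤ l then p i else q (l + m - i)) (fun i j hij hj => ?_) fun i j hij hj => ?_)
  · split_ifs with h1 h2 h2
    · exact hpi i j hij h2
    · rcases Nat.eq_zero_or_pos i with rfl | hi
      · rw [hp.zero, ← hq.zero]
        exact hqi _ _ (by omega) (by omega)
      rcases eq_or_lt_of_le h1 with rfl | hil
      · rw [hp.last, ← hq.last]
        exact (hqi _ _ (by omega) (by omega)).symm
      exact (hKK' _ (hp.mem i hi hil) _ (hq.mem _ (by omega) (by omega))).1
    · omega
    · exact (hqi _ _ (by omega) (by omega)).symm
  · split_ifs with h1 h2 h2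
    · rw [hpa i j hij h2]
      omega
    · rcases Nat.eq_zero_or_pos i with rfl | hi
      · rw [hp.zero, ← hq.zero, hqa _ _ (by omega) (by omega)]
        omega
      rcases eq_or_lt_of_le h1 with rfl | hil
      · rw [hp.last, ← hq.last, G.adj_comm, hqa _ _ (by omega) (by omega)]
        omega
      · refine iff_of_false
          (hKK' _ (hp.mem i hi hil) _ (hq.mem _ (by omega) (by omega))).2 (by omega)
    · omega
    · rw [G.adj_comm, hqa _ _ (by omega) (by omega)]
      omega

/-- The special case of `IsChordal.adj_of_two_sides` in which one side is a single vertex `c`. -/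
lemma IsChordal.adj_of_common_neighbor (hG : G.IsChordal) (hab : a ≠ b) {c : V}
    (hcK : c ∉ K) (hK : ∀ x ∈ K, ¬ G.Adj x c) (h : G.JoinedWithin K u v) (hau : G.Adj a u)
    (hbv : G.Adj b v) (hac : G.Adj a c) (hbc : G.Adj b c) : G.Adj a b := by
  refine hG.adj_of_two_sides (K' := {c}) hab ?_ h hau hbv (.refl rfl) hac hbc
  rintro x hx _ rfl
  exact ⟨fun h => hcK (h ▸ hx), hK x hx⟩

end SimpleGraph

/-! ### Two far vertices without a separating vertex -/

namespace SimpleGraph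

variable {V : Type*} {G : SimpleGraph V} {x x' y z a b d : V}

/-- The vertices of `G` outside the closed neighbourhood of `x`. -/
def farFrom (G : SimpleGraph V) (x : V) : Set V := {v | v ≠ x ∧ ¬ G.Adj x v}

/-- The component of `x'` in the graph obtained by deleting the closed neighbourhood of `x`. It is
empty if `x'` lies in that neighbourhood. -/
def farSide (G : SimpleGraph V) (x x' : V) : Set V := {v | G.JoinedWithin (G.farFrom x) v x'}

/-- The neighbours of `x` that are adjacent to `G.farSide x x'`. In a chordal graph this is a clique
separating `x` from `x'`. -/
def frontier (G : SimpleGraph V) (x x' : V) : Set V :=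
  {a | G.Adj x a ∧ ∃ y ∈ G.farSide x x', G.Adj a y}

lemma not_mem_farSide_self : x ∉ G.farSide x x' := fun h => h.left_mem.1 rfl

lemma mem_frontier_of_exit (hy : y ∈ G.farSide x x') (hz : z ∉ G.farSide x x')
    (h : G.Adj y z) : z ∈ G.frontier x x' := by
  refine ⟨?_, y, hy, h.symm⟩
  by_contra hxz
  have hne : z ≠ x := by
    rintro rfl
    exact hy.left_mem.2 h.symm
  have hzfar : z ∈ G.farFrom x := ⟨hne, hxz⟩
  exact hz ((h.symm.joinedWithin hzfar hy.left_mem).trans hy)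

lemma IsChordal.adj_of_mem_frontier (hG : G.IsChordal) (ha : a ∈ G.frontier x x')
    (hb : b ∈ G.frontier x x') (hab : a ≠ b) : G.Adj a b := by
  obtain ⟨hxa, u, hu, hau⟩ := ha
  obtain ⟨hxb, v, hv, hbv⟩ := hb
  exact hG.adj_of_common_neighbor hab (c := x) (K := G.farFrom x) (fun h => h.1 rfl)
    (fun y hy h => hy.2 h.symm) (hu.trans hv.symm) hau hbv hxa.symm hxb.symm

/-- If `x` and `x'` are not separated by the vertex `d`, the frontier has a vertex other than
`d`. -/
lemma exists_mem_frontier_ne {W : Set V} (h : G.JoinedWithin W x x') (hd : d ∉ W)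
    (hx' : x' ∈ G.farFrom x) : ∃ a ∈ G.frontier x x', a ≠ d := by
  obtain ⟨y, z, hy, hz, -, hzW, hyz⟩ :=
    h.symm.exists_exit (K := G.farSide x x') (.refl hx') not_mem_farSide_self
  exact ⟨z, mem_frontier_of_exit hy hz hyz, fun h => hd (h ▸ hzW)⟩

/-- `x` and `x'` have distance at least 3, are joined by a path, and no single vertex separates
them. -/
structure IsInseparablePair (G : SimpleGraph V) (x x' : V) : Prop where
  ne : x ≠ x'
  not_adj : ¬ G.Adj x x'
  no_common : ∀ z, G.Adj x z → ¬ G.Adj x' z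
  joined : G.JoinedWithin Set.univ x x'
  joined_compl : ∀ d, d ≠ x → d ≠ x' → G.JoinedWithin {d}ᶜ x x'

namespace IsInseparablePair

lemma symm (h : G.IsInseparablePair x x') : G.IsInseparablePair x' x where
  ne := h.ne.symm
  not_adj h' := h.not_adj h'.symm
  no_common z hz hz' := h.no_common z hz' hz
  joined := h.joined.symm
  joined_compl d hd hd' := (h.joined_compl d hd' hd).symm

lemma mem_farFrom (h : G.IsInseparablePair x x') : x' ∈ G.farFrom x := ⟨h.ne.symm, h.not_adj⟩

lemma exists_mem_frontier_ne (h : G.IsInseparablePair x x') (d : V) :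
    ∃ a ∈ G.frontier x x', a ≠ d := by
  by_cases hd : d ≠ x ∧ d ≠ x'
  · exact SimpleGraph.exists_mem_frontier_ne (h.joined_compl d hd.1 hd.2) (by simp) h.mem_farFrom
  · obtain ⟨y, z, hy, hz, -, -, hyz⟩ := h.joined.symm.exists_exit (K := G.farSide x x')
      (.refl h.mem_farFrom) not_mem_farSide_self
    have hz' := mem_frontier_of_exit hy hz hyz
    refine ⟨z, hz', ?_⟩
    rintro rfl
    refine hd ⟨hz'.1.ne', ?_⟩
    rintro rfl
    exact h.not_adj hz'.1

/-- If a frontier vertex `b` of `x` has no neighbour in the frontier of `x'`, then `x` can be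
replaced by `b`, which lies closer to `x'`. -/
lemma of_mem_frontier (h : G.IsInseparablePair x x') (hb : b ∈ G.frontier x x')
    (hno : ∀ z ∈ G.frontier x' x, ¬ G.Adj b z) : G.IsInseparablePair b x' := by
  have hbx' : b ≠ x' := by
    rintro rfl
    exact h.not_adj hb.1
  have hnadj : ¬ G.Adj x' b := h.no_common b hb.1
  refine ⟨hbx', fun h' => hnadj h'.symm, fun z hbz hxz => hno z ⟨hxz, b, ?_, hbz.symm⟩ hbz, ?_,
    fun d hdb hdx' => ?_⟩
  · exact hb.1.symm.joinedWithin ⟨hbx', hnadj⟩ h.symm.mem_farFrom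
  · exact (hb.1.symm.joinedWithin (Set.mem_univ _) (Set.mem_univ _)).trans h.joined
  · rcases eq_or_ne d x with rfl | hdx
    · obtain ⟨y, hy, hby⟩ := hb.2
      exact (hby.joinedWithin hdb.symm hy.left_mem.1).trans (hy.mono fun z hz => hz.1)
    · exact (hb.1.symm.joinedWithin hdb.symm hdx.symm).trans (h.joined_compl d hdx hdx')

lemma farSide_ssubset (hG : G.IsChordal) (hx' : x' ∈ G.farFrom x) (hb : b ∈ G.frontier x x') :
    G.farSide b x' ⊂ G.farSide x x' := by
  refine ⟨fun v hv => ?_, fun hsub => ?_⟩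
  · refine (JoinedWithin.within_of_closed (K := G.farSide x x') (JoinedWithin.symm hv)
      (.refl hx') fun y z hy hz hyz => ?_).right_mem.2
    by_contra hzs
    have hzf := mem_frontier_of_exit hy hzs hyz
    exact hz.2 (hG.adj_of_mem_frontier hb hzf hz.1.symm)
  · obtain ⟨y, hy, hby⟩ := hb.2
    exact (hsub hy).left_mem.2 hby

lemma farSide_eq (h : G.IsInseparablePair x x') (hb : b ∈ G.frontier x x') :
    G.farSide x' b = G.farSide x' x := by
  have hbx' : b ≠ x' := by
    rintro rfl
    exact h.not_adj hb.1
  have hxb : G.JoinedWithin (G.farFrom x') x b :=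
    hb.1.joinedWithin h.symm.mem_farFrom ⟨hbx', h.no_common b hb.1⟩
  ext v
  exact ⟨fun hv => JoinedWithin.trans hv hxb.symm, fun hv => JoinedWithin.trans hv hxb⟩

end IsInseparablePair

/-- If every vertex of a clique `A` has a neighbour in a disjoint clique `B`, then in a chordal
graph some vertex of `B` is adjacent to all of `A`: the neighbourhoods in `A` of the vertices of
`B` form a chain. -/
lemma IsChordal.exists_adj_all [Finite V] (hG : G.IsChordal) {A B : Set V}
    (hA : ∀ a ∈ A, ∀ a' ∈ A, a ≠ a' → G.Adj a a') (hB : ∀ b ∈ B, ∀ b' ∈ B, b ≠ b' → G.Adj b b')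
    (hAB : ∀ a ∈ A, a ∉ B) (hne : B.Nonempty) (h : ∀ a ∈ A, ∃ b ∈ B, G.Adj a b) :
    ∃ u ∈ B, ∀ a ∈ A, G.Adj a u := by
  -- Take `u` with the most neighbours in `A`. If `a` is adjacent to `u'` but not to `u`, some `w`
  -- is adjacent to `u` but not to `u'`, and `a, w, u, u'` span an induced 4-cycle.
  obtain ⟨u, hu, hmax⟩ := Set.exists_max_image B (fun u => {a ∈ A | G.Adj a u}.ncard)
    B.toFinite hne
  refine ⟨u, hu, fun a ha => ?_⟩
  by_contra hau
  obtain ⟨u', hu', hau'⟩ := h a ha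
  obtain ⟨w, ⟨hwA, hwu⟩, hw⟩ : ∃ w ∈ {a ∈ A | G.Adj a u}, w ∉ {a ∈ A | G.Adj a u'} := by
    by_contra hcon
    push Not at hcon
    refine absurd (hmax u' hu') (not_le.2 (Set.ncard_lt_ncard ⟨hcon, fun hsub => ?_⟩))
    exact hau (hsub ⟨ha, hau'⟩).2
  have hwu' : ¬ G.Adj w u' := fun h => hw ⟨hwA, h⟩
  refine hau (hG.adj_of_two_sides (K := {w}) (K' := {u'}) (fun h => hAB a ha (h ▸ hu)) ?_
    (.refl rfl) (hA a ha w hwA ?_) hwu.symm (.refl rfl) hau' (hB u hu u' hu' ?_))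
  · rintro _ rfl _ rfl
    exact ⟨fun h => hAB _ hwA (h ▸ hu'), hwu'⟩
  · rintro rfl
    exact hau hwu
  · rintro rfl
    exact hau hau'

lemma isIndContained_of_lt {n : ℕ} {F : SimpleGraph (Fin n)} (f : Fin n → V)
    (h : ∀ i j, i < j → f i ≠ f j ∧ (G.Adj (f i) (f j) ↔ F.Adj i j)) : F.IsIndContained G := by
  refine ⟨⟨⟨f, fun i j hij => ?_⟩, fun {i j} => ?_⟩⟩
  · rcases lt_trichotomy i j with hlt | heq | hlt
    · exact absurd hij (h i j hlt).1
    · exact heq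
    · exact absurd hij.symm (h j i hlt).1
  · change G.Adj (f i) (f j) ↔ _
    rcases lt_trichotomy i j with hlt | rfl | hlt
    · exact (h i j hlt).2
    · simp
    · rw [G.adj_comm, F.adj_comm]
      exact (h j i hlt).2

lemma isIndContained_graphF1_or_graphF2 {b v u b' : V} (hxx' : x ≠ x') (hnxx' : ¬ G.Adj x x')
    (hxb : G.Adj x b) (hxv : G.Adj x v) (hbv : G.Adj b v) (hbu : G.Adj b u) (hvu : G.Adj v u)
    (hvb' : G.Adj v b') (hub' : G.Adj u b') (hux' : G.Adj u x') (hb'x' : G.Adj b' x')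
    (hxu : ¬ G.Adj x u) (hxb' : ¬ G.Adj x b') (hbx' : ¬ G.Adj b x') (hvx' : ¬ G.Adj v x') :
    graphF1.IsIndContained G ∨ graphF2.IsIndContained G := by
  have h1 : x ≠ u := fun h => hnxx' (h ▸ hux')
  have h2 : x ≠ b' := fun h => hnxx' (h ▸ hb'x')
  have h3 : b ≠ b' := fun h => hxb' (h ▸ hxb)
  have h4 : b ≠ x' := fun h => hnxx' (h ▸ hxb)
  have h5 : v ≠ x' := fun h => hnxx' (h ▸ hxv)
  by_cases hbb' : G.Adj b b'
  · refine .inr (isIndContained_of_lt ![x, b, v, u, b', x'] fun i j hij => ?_)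
    fin_cases i <;> fin_cases j <;> first
      | exact absurd hij (by decide)
      | exact ⟨Adj.ne ‹_›, iff_of_true (by assumption) (by decide)⟩
      | exact ⟨by assumption, iff_of_false (by assumption) (by decide)⟩
  · refine .inl (isIndContained_of_lt ![x, b, v, u, b', x'] fun i j hij => ?_)
    fin_cases i <;> fin_cases j <;> first
      | exact absurd hij (by decide)
      | exact ⟨Adj.ne ‹_›, iff_of_true (by assumption) (by decide)⟩
      | exact ⟨by assumption, iff_of_false (by assumption) (by decide)⟩

/-- In a chordal graph, an inseparable pair yields an induced `F₁` or `F₂`. Moving `x` and `x'`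
towards each other as long as possible, one reaches a pair for which every vertex of either
frontier has a neighbour in the other one; then both frontiers have a vertex adjacent to the
whole other frontier. -/
theorem IsInseparablePair.isIndContained [Finite V] (hG : G.IsChordal)
    (h : G.IsInseparablePair x x') : graphF1.IsIndContained G ∨ graphF2.IsIndContained G := by
  induction hn : (G.farSide x x').ncard + (G.farSide x' x).ncard using Nat.strong_induction_on
    generalizing x x' with
  | _ n ih =>
  subst hn
  by_cases h1 : ∃ b ∈ G.frontier x x', ∀ z ∈ G.frontier x' x, ¬ G.Adj b z
  · obtain ⟨b, hb, hno⟩ := h1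
    refine ih _ ?_ (h.of_mem_frontier hb hno) rfl
    rw [h.farSide_eq hb]
    have := Set.ncard_lt_ncard (farSide_ssubset hG h.mem_farFrom hb)
    omega
  by_cases h2 : ∃ b ∈ G.frontier x' x, ∀ z ∈ G.frontier x x', ¬ G.Adj b z
  · obtain ⟨b, hb, hno⟩ := h2
    refine ih _ ?_ (h.symm.of_mem_frontier hb hno).symm rfl
    rw [h.symm.farSide_eq hb]
    have := Set.ncard_lt_ncard (farSide_ssubset hG h.symm.mem_farFrom hb)
    omega
  push Not at h1 h2
  have hA : ∀ a ∈ G.frontier x x', ∀ a' ∈ G.frontier x x', a ≠ a' → G.Adj a a' :=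
    fun a ha a' ha' => hG.adj_of_mem_frontier ha ha'
  have hA' : ∀ a ∈ G.frontier x' x, ∀ a' ∈ G.frontier x' x, a ≠ a' → G.Adj a a' :=
    fun a ha a' ha' => hG.adj_of_mem_frontier ha ha'
  have hdisj : ∀ a ∈ G.frontier x x', a ∉ G.frontier x' x :=
    fun a ha ha' => h.no_common a ha.1 ha'.1
  obtain ⟨a₀, ha₀, -⟩ := h.exists_mem_frontier_ne x
  obtain ⟨a₁, ha₁, -⟩ := h.symm.exists_mem_frontier_ne x
  obtain ⟨u, hu, hua⟩ := hG.exists_adj_all hA hA' hdisj ⟨a₁, ha₁⟩ h1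
  obtain ⟨v, hv, hva⟩ := hG.exists_adj_all hA' hA (fun a ha ha' => hdisj a ha' ha) ⟨a₀, ha₀⟩ h2
  obtain ⟨b, hb, hbv⟩ := h.exists_mem_frontier_ne v
  obtain ⟨b', hb', hbu'⟩ := h.symm.exists_mem_frontier_ne u
  exact isIndContained_graphF1_or_graphF2 h.ne h.not_adj hb.1 hv.1 (hA b hb v hv hbv)
    (hua b hb) (hua v hv) (hva b' hb').symm (hA' u hu b' hb' hbu'.symm) hu.1.symm hb'.1.symm
    (fun h' => h.no_common u h' hu.1) (fun h' => h.no_common b' h' hb'.1)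
    (fun h' => h.no_common b hb.1 h'.symm) fun h' => h.no_common v hv.1 h'.symm

end SimpleGraph

/-! ### Two far vertices with a separating vertex -/

namespace SimpleGraph

variable {V : Type*} {G : SimpleGraph V} {K W : Set V} {x x' a b c d u v : V} {l : ℕ} {p : ℕ → V}

lemma JoinedWithin.joinedWithin_of_separates (h : G.JoinedWithin W a b)
    (hc : ¬ G.JoinedWithin {c}ᶜ a b) : G.JoinedWithin W a c := by
  classical
  obtain ⟨w, hw⟩ := h
  have hcw : c ∈ w.support := by
    by_contra hcw
    exact hc ⟨w, fun z hz hzc => hcw (hzc ▸ hz)⟩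
  exact ⟨w.takeUntil c hcw, fun z hz => hw z (w.support_takeUntil_subset_support hcw hz)⟩

lemma IsConnectingSeq.joinedWithin (hp : G.IsConnectingSeq K a b l p) {i j : ℕ} (hij : i ≤ j)
    (hjl : j ≤ l) (hW : ∀ k, i ≤ k → k ≤ j → p k ∈ W) : G.JoinedWithin W (p i) (p j) := by
  induction j, hij using Nat.le_induction with
  | base => exact .refl (hW i le_rfl le_rfl)
  | succ j hij ih =>
    exact (ih (by omega) fun k hk hkj => hW k hk (by omega)).trans
      ((hp.adj j (by omega)).joinedWithin (hW j hij (by omega)) (hW _ (by omega) le_rfl))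

lemma IsConnectingSeq.reverse (hp : G.IsConnectingSeq K a b l p) :
    G.IsConnectingSeq K b a l fun i => p (l - i) where
  two_le := hp.two_le
  zero := by simpa using hp.last
  last := by simpa using hp.zero
  mem i hi hil := hp.mem _ (by omega) (by omega)
  adj i hi := by
    have := (hp.adj (l - (i + 1)) (by omega)).symm
    rwa [show l - (i + 1) + 1 = l - i by omega] at this

/-- If `x` and `c` are joined, not adjacent, and not separated by a vertex, then `c` is a tip of an
induced diamond on the side of `x`. -/
lemma IsChordal.exists_diamond (hG : G.IsChordal) (hxc : x ∈ G.farFrom c)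
    (hsep : ∀ d, d ≠ c → d ≠ x → G.JoinedWithin {d}ᶜ c x) (hj : G.JoinedWithin Set.univ c x) :
    ∃ L : Fin 3 → V, (∀ i j, i ≠ j → G.Adj (L i) (L j)) ∧ (∀ i, G.Adj (L i) c ↔ i ≠ 0) ∧
      ∀ i, G.JoinedWithin {c}ᶜ (L i) x := by
  obtain ⟨y, a, hy, hz, -, -, hya⟩ :=
    hj.symm.exists_exit (K := G.farSide c x) (.refl hxc) not_mem_farSide_self
  have ha := mem_frontier_of_exit hy hz hya
  have hax : a ≠ x := by
    rintro rfl
    exact hxc.2 ha.1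
  obtain ⟨b, hb, hba⟩ := SimpleGraph.exists_mem_frontier_ne (hsep a ha.1.ne' hax)
    (fun h => h rfl) hxc
  have hab := hG.adj_of_mem_frontier ha hb hba.symm
  obtain ⟨hca, u, hu, hau⟩ := ha
  obtain ⟨hcb, v, hv, hbv⟩ := hb
  obtain ⟨x₁, hx₁, hx₁a, hx₁b⟩ := hG.exists_common_neighbor hab (K := G.farFrom c)
    (fun h => h.2 hca) (fun h => h.2 hcb) (hu.trans hv.symm) hau hbv
  have hside : ∀ {y}, y ∈ G.farSide c x → G.JoinedWithin {c}ᶜ y x := fun hy =>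
    hy.mono fun z hz => hz.1
  have hja := (hau.joinedWithin hca.ne' (hside hu).left_mem).trans (hside hu)
  have hjb := (hbv.joinedWithin hcb.ne' (hside hv).left_mem).trans (hside hv)
  refine ⟨![x₁, a, b], ?_, ?_, ?_⟩
  · intro i j hij
    fin_cases i <;> fin_cases j <;> simp [hx₁a, hx₁b, hab, hx₁a.symm, hx₁b.symm, hab.symm] at hij ⊢
  · have : ¬ G.Adj x₁ c := fun h => hx₁.2 h.symm
    intro i
    fin_cases i <;> simp [this, hca.symm, hcb.symm]
  · intro i
    fin_cases i
    · exact (hx₁a.joinedWithin hx₁.1 hja.left_mem).trans hja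
    · exact hja
    · exact hjb

lemma isIndContained_graphH {n : ℕ} {L R : Fin 3 → V} {q : ℕ → V}
    (hL : ∀ i j, i ≠ j → G.Adj (L i) (L j)) (hR : ∀ i j, i ≠ j → G.Adj (R i) (R j))
    (hq : ∀ i j, i < j → j < n → q i ≠ q j ∧ (G.Adj (q i) (q j) ↔ j = i + 1))
    (hLq : ∀ i j, j < n → L i ≠ q j ∧ (G.Adj (L i) (q j) ↔ i ≠ 0 ∧ j = 0))
    (hqR : ∀ i j, j < n → R i ≠ q j ∧ (G.Adj (R i) (q j) ↔ i ≠ 0 ∧ j + 1 = n))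
    (hLR : ∀ i j, L i ≠ R j ∧ ¬ G.Adj (L i) (R j)) : (graphH n).IsIndContained G := by
  have hLinj : ∀ i j, L i = L j → i = j := fun i j h => by
    by_contra hij
    exact (hL i j hij).ne h
  have hRinj : ∀ i j, R i = R j → i = j := fun i j h => by
    by_contra hij
    exact (hR i j hij).ne h
  have hqinj : ∀ i j : Fin n, q i = q j → i = j := fun i j h => by
    rcases lt_trichotomy i j with hij | hij | hij
    · exact absurd h (hq i j hij j.2).1
    · exact hij
    · exact absurd h.symm (hq j i hij i.2).1
  refine ⟨⟨⟨fun v => match v with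
    | .inl i => L i
    | .inr (.inl i) => q i
    | .inr (.inr i) => R i, ?_⟩, ?_⟩⟩
  · rintro (i | i | i) (j | j | j) h
    · rw [hLinj i j h]
    · exact absurd h (hLq i j j.2).1
    · exact absurd h (hLR i j).1
    · exact absurd h.symm (hLq j i i.2).1
    · rw [hqinj i j h]
    · exact absurd h.symm (hqR j i i.2).1
    · exact absurd h.symm (hLR j i).1
    · exact absurd h (hqR i j j.2).1
    · rw [hRinj i j h]
  · rintro (i | i | i) (j | j | j)
    · change G.Adj (L i) (L j) ↔ _
      by_cases hij : i = j
      · simp [hij]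
      · simp [graphH, graphHRel, hij, hL i j hij]
    · change G.Adj (L i) (q j) ↔ _
      simp [graphH, graphHRel, (hLq i j j.2).2]
    · change G.Adj (L i) (R j) ↔ _
      simp [graphH, graphHRel, (hLR i j).2]
    · change G.Adj (q i) (L j) ↔ _
      rw [G.adj_comm]
      simp [graphH, graphHRel, (hLq j i i.2).2]
    · change G.Adj (q i) (q j) ↔ _
      rcases lt_trichotomy i j with hij | rfl | hij
      · rw [(hq i j hij j.2).2]
        have : i.val < j.val := hij
        simp only [graphH, graphHRel, fromRel_adj, ne_eq, Sum.inr.injEq, Sum.inl.injEq,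
          Fin.ext_iff]
        omega
      · simp
      · rw [G.adj_comm, (hq j i hij i.2).2]
        have : j.val < i.val := hij
        simp only [graphH, graphHRel, fromRel_adj, ne_eq, Sum.inr.injEq, Sum.inl.injEq,
          Fin.ext_iff]
        omega
    · change G.Adj (q i) (R j) ↔ _
      rw [G.adj_comm]
      simp [graphH, graphHRel, (hqR j i i.2).2, and_comm]
    · change G.Adj (R i) (L j) ↔ _
      rw [G.adj_comm]
      simp [graphH, graphHRel, (hLR j i).2]
    · change G.Adj (R i) (q j) ↔ _
      simp [graphH, graphHRel, (hqR i j j.2).2, and_comm]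
    · change G.Adj (R i) (R j) ↔ _
      by_cases hij : i = j
      · simp [hij]
      · simp [graphH, graphHRel, hij, hR i j hij]

/-- The first separating vertex on a path from `x` to `x'` is a tip of an induced diamond on the
side of `x`. -/
lemma IsConnectingSeq.exists_diamond_first (hG : G.IsChordal)
    (hp : G.IsConnectingSeq K x x' l p)
    (hsep : ∀ d, G.Adj x d → G.JoinedWithin {d}ᶜ x x') {s : ℕ} (hsl : s ≤ l) (hxs : x ≠ p s)
    (hs : ¬ G.JoinedWithin {p s}ᶜ x x')
    (hfirst : ∀ j, 0 < j → j < s → G.JoinedWithin {p j}ᶜ x x') :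
    ∃ L : Fin 3 → V, (∀ i j, i ≠ j → G.Adj (L i) (L j)) ∧ (∀ i, G.Adj (L i) (p s) ↔ i ≠ 0) ∧
      ∀ i, G.JoinedWithin {p s}ᶜ (L i) x := by
  refine hG.exists_diamond ⟨hxs, fun h => hs (hsep _ h.symm)⟩ (fun d hdc hdx => ?_) ?_
  · by_contra hd
    obtain ⟨j, hjs, rfl⟩ : ∃ j ≤ s, p j = d := by
      by_contra hcon
      push Not at hcon
      have := hp.joinedWithin (W := {d}ᶜ) (Nat.zero_le s) hsl fun k _ hk => hcon k hk
      rw [hp.zero] at this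
      exact hd this.symm
    have hj0 : 0 < j := Nat.pos_of_ne_zero fun h => hdx (by rw [h, hp.zero])
    have hjs' : j < s := lt_of_le_of_ne hjs fun h => hdc (by rw [h])
    exact hd ((hfirst j hj0 hjs').joinedWithin_of_separates hs).symm
  · have := hp.joinedWithin (W := Set.univ) (Nat.zero_le s) hsl fun _ _ _ => Set.mem_univ _
    rw [hp.zero] at this
    exact this.symm

/-- Suppose that some vertex separates `x` from `x'`, but no neighbour of `x` or `x'` does. Then a
chordless path from `x` to `x'`, restricted to the part between the first and the last separating
vertex on it, extends by a diamond at either end to an induced `Hₙ`. -/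
theorem IsChordal.exists_graphH_isIndContained (hG : G.IsChordal) (hne : x ≠ x')
    (hnadj : ¬ G.Adj x x') (hj : G.JoinedWithin Set.univ x x')
    (hsep : ∀ d, G.Adj x d → G.JoinedWithin {d}ᶜ x x')
    (hsep' : ∀ d, G.Adj x' d → G.JoinedWithin {d}ᶜ x x')
    (hc : ∃ c, c ≠ x ∧ c ≠ x' ∧ ¬ G.JoinedWithin {c}ᶜ x x') :
    ∃ n, 1 ≤ n ∧ (graphH n).IsIndContained G := by
  obtain ⟨l, p, hp, hchord⟩ : ∃ l p, G.IsConnectingSeq Set.univ x x' l p ∧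
      ∀ i j, i + 1 < j → j ≤ l → (i = 0 → j ≠ l) → ¬ G.Adj (p i) (p j) := by
    obtain ⟨y, u, hy, -, -, -, hyu⟩ := hj.exists_exit (K := {x}) rfl hne.symm
    obtain ⟨y', u', hy', -, -, -, hyu'⟩ := hj.symm.exists_exit (K := {x'}) rfl hne
    rw [Set.mem_singleton_iff] at hy hy'
    subst hy hy'
    have huniv : ∀ {y z}, G.Adj y z → G.JoinedWithin Set.univ y z := fun h =>
      h.joinedWithin (Set.mem_univ _) (Set.mem_univ _)
    exact exists_chordless (((huniv hyu.symm).trans (hj.trans (huniv hyu'))).exists_isConnectingSeq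
      hyu hyu')
  have hinj := fun i j => hp.injective_of_chordless hchord hne (.inl hnadj) (i := i) (j := j)
  have hadj := fun i j => hp.adj_iff_of_chordless hchord (i := i) (j := j)
  simp only [hnadj, and_false, or_false] at hadj
  classical
  -- The indices of the inner separating vertices of the path.
  let S : Finset ℕ := {i ∈ Finset.Ioo 0 l | ¬ G.JoinedWithin {p i}ᶜ x x'}
  have hS : ∀ {i}, i ∈ S ↔ (0 < i ∧ i < l) ∧ ¬ G.JoinedWithin {p i}ᶜ x x' := by
    intro i
    rw [Finset.mem_filter, Finset.mem_Ioo]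
  have hSne : S.Nonempty := by
    obtain ⟨c, hcx, hcx', hc⟩ := hc
    obtain ⟨i, hil, rfl⟩ : ∃ i ≤ l, p i = c := by
      by_contra hcon
      push Not at hcon
      have := hp.joinedWithin (W := {c}ᶜ) (Nat.zero_le l) le_rfl fun k _ hk => hcon k hk
      rw [hp.zero, hp.last] at this
      exact hc this
    refine ⟨i, hS.2 ⟨⟨Nat.pos_of_ne_zero ?_, lt_of_le_of_ne hil ?_⟩, hc⟩⟩
    · rintro rfl
      exact hcx hp.zero
    · rintro rfl
      exact hcx' hp.last
  obtain ⟨s, hsS, hsmin⟩ := S.exists_min_image id hSne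
  obtain ⟨t, htS, htmax⟩ := S.exists_max_image id hSne
  obtain ⟨⟨hs0, hsl⟩, hs⟩ := hS.1 hsS
  obtain ⟨⟨ht0, htl⟩, ht⟩ := hS.1 htS
  have hst : s ≤ t := hsmin t htS
  obtain ⟨L, hL, hLs, hLj⟩ := hp.exists_diamond_first hG hsep hsl.le
    (hp.zero ▸ hinj 0 s hs0 hsl.le) hs fun j hj0 hjs => by
      by_contra hcon
      have : s ≤ j := hsmin j (hS.2 ⟨⟨hj0, by omega⟩, hcon⟩)
      omega
  obtain ⟨R, hR, hRt, hRj⟩ := hp.reverse.exists_diamond_first hG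
    (fun d hd => (hsep' d hd).symm) (s := l - t) (by omega)
    (by simpa only [Nat.sub_sub_self htl.le, hp.last] using (hinj t l htl le_rfl).symm)
    (by simpa only [Nat.sub_sub_self htl.le] using fun h => ht h.symm) fun j hj0 hjs => by
      by_contra hcon
      have : l - j ≤ t := htmax (l - j) (hS.2 ⟨⟨by omega, by omega⟩, fun h => hcon h.symm⟩)
      omega
  simp only [Nat.sub_sub_self htl.le] at hRt hRj
  -- Beyond the first separating vertex, the path leaves the side of `x`; similarly for `x'`.
  have hXp : ∀ i, s ≤ i → i ≤ l → ¬ G.JoinedWithin {p s}ᶜ (p i) x := by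
    intro i hsi hil h
    have hne : i ≠ s := fun h' => h.left_mem (by rw [h']; rfl)
    have := hp.joinedWithin (W := {p s}ᶜ) hil le_rfl fun k hk hkl =>
      (hinj s k (by omega) hkl).symm
    rw [hp.last] at this
    exact hs (h.symm.trans this)
  have hXp' : ∀ i, i ≤ t → ¬ G.JoinedWithin {p t}ᶜ (p i) x' := by
    intro i hit h
    have hne : i ≠ t := fun h' => h.left_mem (by rw [h']; rfl)
    have := hp.joinedWithin (W := {p t}ᶜ) (Nat.zero_le i) (by omega) fun k hk hkl =>
      hinj k t (by omega) htl.le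
    rw [hp.zero] at this
    exact ht (this.trans h)
  -- The last separating vertex is not on the side of `x`, so this side survives its deletion.
  have hXt : ∀ {v}, G.JoinedWithin {p s}ᶜ v x → G.JoinedWithin {p t}ᶜ v x := by
    intro v hv
    refine (hv.symm.within_of_closed (K := {v | G.JoinedWithin {p s}ᶜ v x})
      (.refl hv.right_mem) fun y z hy hz hyz => ?_).symm.mono ?_
    · exact (hyz.symm.joinedWithin hz (JoinedWithin.left_mem hy)).trans hy
    · rintro z ⟨-, hz⟩ rfl
      exact hXp t hst htl.le hz
  refine ⟨t - s + 1, by omega, isIndContained_graphH (L := L) (R := R) (q := fun i => p (s + i))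
    hL hR (fun i j hij hj => ?_) (fun i j hj => ⟨?_, ?_⟩) (fun i j hj => ⟨?_, ?_⟩) fun i j => ?_⟩
  · refine ⟨hinj _ _ (by omega) (by omega), ?_⟩
    rw [hadj _ _ (by omega) (by omega)]
    omega
  · intro h
    exact hXp (s + j) (by omega) (by omega) (h ▸ hLj i)
  · rcases Nat.eq_zero_or_pos j with rfl | hj0
    · simpa using hLs i
    · refine iff_of_false (fun h => ?_) (by omega)
      exact hXp (s + j) (by omega) (by omega) ((h.symm.joinedWithin
        (hinj s (s + j) (by omega) (by omega)).symm (hLj i).left_mem).trans (hLj i))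
  · intro h
    exact hXp' (s + j) (by omega) (h ▸ hRj i)
  · by_cases hjt : j = t - s
    · subst hjt
      simp only [Nat.add_sub_cancel' hst]
      rw [hRt i]
      simp
    · refine iff_of_false (fun h => ?_) (by omega)
      exact hXp' (s + j) (by omega) ((h.symm.joinedWithin
        (hinj (s + j) t (by omega) (by omega)) (hRj i).left_mem).trans (hRj i))
  · have hi := hXt (hLj i)
    refine ⟨fun h => ht (hi.symm.trans (h ▸ hRj j)), fun h => ht ?_⟩
    exact (hi.symm.trans (h.joinedWithin hi.left_mem (hRj j).left_mem)).trans (hRj j)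

end SimpleGraph

/-! ### Minimal cutsets of chordal graphs -/

namespace SimpleGraph

variable {V : Type*} {G : SimpleGraph V} {S S' W : Set V} {x x' a b a' b' s t u v z d : V}

lemma JoinedWithin.within_component (h : G.JoinedWithin W u v) :
    G.JoinedWithin {z | G.JoinedWithin W z v} u v :=
  (h.within_of_closed (K := {z | G.JoinedWithin W z v}) h fun _ _ hy hz hyz =>
    (hyz.symm.joinedWithin hz (JoinedWithin.left_mem hy)).trans hy).mono Set.inter_subset_right

lemma IsCutset.exists_not_joinedWithin (hS : G.IsCutset S) (u : V) :
    ∃ v, v ∉ S ∧ ¬ G.JoinedWithin Sᶜ v u := by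
  obtain ⟨v, hv, w, hw, hvw⟩ := isCutset_iff.1 hS
  by_cases h : G.JoinedWithin Sᶜ v u
  · exact ⟨w, hw, fun h' => hvw (h.trans h'.symm)⟩
  · exact ⟨v, hv, h⟩

/-- Every vertex of a minimal cutset `S` has neighbours in all components of `G - S`. -/
lemma exists_adj_of_minimal_isCutset (hS : Minimal G.IsCutset S) (hs : s ∈ S) (hu : u ∉ S) :
    ∃ v, G.JoinedWithin Sᶜ v u ∧ G.Adj s v := by
  have hnot : ¬ G.IsCutset (S \ {s}) := fun h => (hS.2 h Set.sdiff_subset hs).2 rfl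
  obtain ⟨w, hw, hwu⟩ := hS.1.exists_not_joinedWithin u
  have hj : G.JoinedWithin (S \ {s})ᶜ u w := by
    by_contra hcon
    exact hnot (isCutset_iff.2 ⟨u, fun h => hu h.1, w, fun h => hw h.1, hcon⟩)
  obtain ⟨y, z, hy, hz, -, hzS, hyz⟩ :=
    hj.exists_exit (K := {v | G.JoinedWithin Sᶜ v u}) (.refl hu) hwu
  have hzS' : z ∈ S := by
    by_contra h
    exact hz ((hyz.symm.joinedWithin h (JoinedWithin.left_mem hy)).trans hy)
  have hzs : z = s := by
    by_contra h
    exact hzS ⟨hzS', h⟩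
  exact ⟨y, hy, hzs ▸ hyz.symm⟩

/-- Minimal cutsets of chordal graphs are cliques. -/
lemma IsChordal.adj_of_minimal_isCutset (hG : G.IsChordal) (hS : Minimal G.IsCutset S)
    (hs : s ∈ S) (ht : t ∈ S) (hst : s ≠ t) : G.Adj s t := by
  obtain ⟨u, hu, v, hv, huv⟩ := isCutset_iff.1 hS.1
  obtain ⟨y, hy, hsy⟩ := exists_adj_of_minimal_isCutset hS hs hu
  obtain ⟨z, hz, htz⟩ := exists_adj_of_minimal_isCutset hS ht hu
  obtain ⟨y', hy', hsy'⟩ := exists_adj_of_minimal_isCutset hS hs hv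
  obtain ⟨z', hz', htz'⟩ := exists_adj_of_minimal_isCutset hS ht hv
  refine hG.adj_of_two_sides hst ?_ (hy.within_component.trans hz.within_component.symm) hsy htz
    (hy'.within_component.trans hz'.within_component.symm) hsy' htz'
  intro p hp q hq
  refine ⟨fun h => huv (hp.symm.trans (h ▸ hq)), fun h => huv ?_⟩
  exact (hp.symm.trans (h.joinedWithin hp.left_mem hq.left_mem)).trans hq

/-- Two vertices of a minimal cutset `S` have a common neighbour in some component of `G - S` other
than that of a given vertex `u`. -/
lemma IsChordal.exists_adj_adj_of_minimal_isCutset (hG : G.IsChordal)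
    (hS : Minimal G.IsCutset S) (ha : a ∈ S) (hb : b ∈ S) (hab : a ≠ b) (u : V) :
    ∃ x, x ∉ S ∧ ¬ G.JoinedWithin Sᶜ x u ∧ G.Adj x a ∧ G.Adj x b := by
  obtain ⟨y, hy, hyu⟩ := hS.1.exists_not_joinedWithin u
  obtain ⟨v, hv, hav⟩ := exists_adj_of_minimal_isCutset hS ha hy
  obtain ⟨w, hw, hbw⟩ := exists_adj_of_minimal_isCutset hS hb hy
  obtain ⟨x, hx, hxa, hxb⟩ := hG.exists_common_neighbor
    (hG.adj_of_minimal_isCutset hS ha hb hab) (fun h : G.JoinedWithin Sᶜ a y => h.left_mem ha)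
    (fun h : G.JoinedWithin Sᶜ b y => h.left_mem hb)
    (hv.within_component.trans hw.within_component.symm)
    hav hbw
  exact ⟨x, JoinedWithin.left_mem hx,
    fun h => hyu (JoinedWithin.trans (JoinedWithin.symm hx) h), hxa, hxb⟩

/-- If `S'` is a clique meeting the component of `u` in `G - S`, no vertex of `S'` lies in another
component. -/
lemma not_joinedWithin_of_clique (hS' : ∀ s ∈ S', ∀ t ∈ S', s ≠ t → G.Adj s t) (hu : u ∈ S')
    (huS : u ∉ S) (hxu : ¬ G.JoinedWithin Sᶜ x u) (hv : v ∈ S') : ¬ G.JoinedWithin Sᶜ x v := by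
  intro h
  rcases eq_or_ne v u with rfl | hvu
  · exact hxu h
  · exact hxu (h.trans ((hS' v hv u hu hvu).joinedWithin h.right_mem huS))

/-- No neighbour `d` of `x` separates `x` from `x'` in `G - (S ∩ S')`, as `x` has two neighbours in
`S \ S'`, both of which have neighbours in the component of `x'` in `G - S`. -/
lemma joinedWithin_compl_of_adj (hS : Minimal G.IsCutset S) (ha : a ∈ S \ S') (hb : b ∈ S \ S')
    (hab : a ≠ b) (hx : x ∉ S) (hx' : x' ∉ S) (hxx' : ¬ G.JoinedWithin Sᶜ x x')
    (hxa : G.Adj x a) (hxb : G.Adj x b) (hxd : G.Adj x d) :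
    G.JoinedWithin ({d}ᶜ ∩ (S ∩ S')ᶜ) x x' := by
  obtain ⟨c, hc, hcd, hxc⟩ : ∃ c ∈ S \ S', c ≠ d ∧ G.Adj x c := by
    by_cases h : a = d
    · exact ⟨b, hb, fun h' => hab (h.trans h'.symm), hxb⟩
    · exact ⟨a, ha, h, hxa⟩
  obtain ⟨v, hv, hcv⟩ := exists_adj_of_minimal_isCutset hS hc.1 hx'
  have hsub : {z | G.JoinedWithin Sᶜ z x'} ⊆ {d}ᶜ ∩ (S ∩ S')ᶜ := by
    refine fun z hz => ⟨?_, fun h => JoinedWithin.left_mem hz h.1⟩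
    rintro rfl
    exact hxx' ((hxd.joinedWithin hx (JoinedWithin.left_mem hz)).trans hz)
  have hcmem : c ∈ {d}ᶜ ∩ (S ∩ S')ᶜ := ⟨hcd, fun h => hc.2 h.2⟩
  have hxmem : x ∈ {d}ᶜ ∩ (S ∩ S')ᶜ := ⟨hxd.ne, fun h => hx h.1⟩
  exact (hxc.joinedWithin hxmem hcmem).trans ((hcv.joinedWithin hcmem (hsub hv)).trans
    (hv.within_component.mono hsub))

/-- In a chordal graph, two minimal cutsets `S` and `S'` with at least two vertices in each of
`S \ S'` and `S' \ S` force one of the forbidden induced subgraphs. It is found in `G - (S ∩ S')`,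
between a vertex `x` seen by two vertices of `S \ S'` on the side of `S` opposite to `S'`, and a
vertex `x'` chosen in the same way with `S` and `S'` exchanged. -/
theorem IsChordal.isIndContained_of_minimal_isCutset [Finite V] (hG : G.IsChordal)
    (hS : Minimal G.IsCutset S) (hS' : Minimal G.IsCutset S') (ha : a ∈ S \ S') (hb : b ∈ S \ S')
    (hab : a ≠ b) (ha' : a' ∈ S' \ S) (hb' : b' ∈ S' \ S) (hab' : a' ≠ b') :
    graphF1.IsIndContained G ∨ graphF2.IsIndContained G ∨
      ∃ n, 1 ≤ n ∧ (graphH n).IsIndContained G := by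
  have hcl := fun s hs t ht => hG.adj_of_minimal_isCutset hS (s := s) (t := t) hs ht
  have hcl' := fun s hs t ht => hG.adj_of_minimal_isCutset hS' (s := s) (t := t) hs ht
  obtain ⟨x, hxS, hxa', hxa, hxb⟩ := hG.exists_adj_adj_of_minimal_isCutset hS ha.1 hb.1 hab a'
  obtain ⟨x', hxS', hx'a, hxa'', hxb'⟩ :=
    hG.exists_adj_adj_of_minimal_isCutset hS' ha'.1 hb'.1 hab' a
  have hxnS' : x ∉ S' := fun h =>
    not_joinedWithin_of_clique hcl' ha'.1 ha'.2 hxa' h (.refl hxS)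
  have hx'nS : x' ∉ S := fun h =>
    not_joinedWithin_of_clique hcl ha.1 ha.2 hx'a h (.refl hxS')
  have hsep : ¬ G.JoinedWithin Sᶜ x x' := fun h =>
    hxa' (h.trans (hxa''.joinedWithin hx'nS ha'.2))
  have hsep' : ¬ G.JoinedWithin S'ᶜ x' x := fun h =>
    hx'a (h.trans (hxa.joinedWithin hxnS' ha.2))
  have hdS : ∀ d, G.Adj x d → G.JoinedWithin ({d}ᶜ ∩ (S ∩ S')ᶜ) x x' := fun d hd =>
    joinedWithin_compl_of_adj hS ha hb hab hxS hx'nS hsep hxa hxb hd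
  have hdS' : ∀ d, G.Adj x' d → G.JoinedWithin ({d}ᶜ ∩ (S ∩ S')ᶜ) x x' := fun d hd =>
    (Set.inter_comm S S' ▸
      joinedWithin_compl_of_adj hS' ha' hb' hab' hxS' hxnS' hsep' hxa'' hxb' hd).symm
  have hno : ∀ z, G.Adj x z → G.Adj x' z → z ∈ S ∩ S' := by
    refine fun z hxz hxz' => ⟨?_, ?_⟩ <;> by_contra hz
    · exact hsep ((hxz.joinedWithin hxS hz).trans (hxz'.symm.joinedWithin hz hx'nS))
    · exact hsep' ((hxz'.joinedWithin hxS' hz).trans (hxz.symm.joinedWithin hz hxnS'))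
  -- Pass to the induced subgraph on the complement of `S ∩ S'`.
  have hind : (G.induce (S ∩ S')ᶜ).IsIndContained G := ⟨Embedding.induce _⟩
  have hG' : (G.induce (S ∩ S')ᶜ).IsChordal := fun k hk h => hG k hk (h.trans hind)
  have hjoin : ∀ (W : Set ↑(S ∩ S')ᶜ) (W' : Set V) (u v : ↑(S ∩ S')ᶜ),
      (∀ z (hz : z ∈ (S ∩ S')ᶜ), z ∈ W' → ⟨z, hz⟩ ∈ W) →
      G.JoinedWithin (W' ∩ (S ∩ S')ᶜ) u v → (G.induce (S ∩ S')ᶜ).JoinedWithin W u v :=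
    fun W W' u v h hj => joinedWithin_induce_iff.2
      (hj.mono fun z hz => ⟨⟨z, hz.2⟩, h z hz.2 hz.1, rfl⟩)
  let y : ↑(S ∩ S')ᶜ := ⟨x, fun h => hxS h.1⟩
  let y' : ↑(S ∩ S')ᶜ := ⟨x', fun h => hx'nS h.1⟩
  have hne : y ≠ y' := fun h => by
    have hxx' : x = x' := Subtype.ext_iff.1 h
    exact hsep (hxx' ▸ .refl hxS)
  have hnadj : ¬ (G.induce (S ∩ S')ᶜ).Adj y y' := fun h =>
    hsep (Adj.joinedWithin (show G.Adj x x' from h) hxS hx'nS)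
  have hj : (G.induce (S ∩ S')ᶜ).JoinedWithin Set.univ y y' :=
    hjoin _ {a}ᶜ _ _ (fun _ _ _ => Set.mem_univ _) (hdS a hxa)
  by_cases hc : ∃ c, c ≠ y ∧ c ≠ y' ∧ ¬ (G.induce (S ∩ S')ᶜ).JoinedWithin {c}ᶜ y y'
  · obtain ⟨n, hn, h⟩ := hG'.exists_graphH_isIndContained hne hnadj hj
      (fun d hd => hjoin _ {d.1}ᶜ _ _ (fun z hz h h' => h (Subtype.ext_iff.1 h')) (hdS d hd))
      (fun d hd => hjoin _ {d.1}ᶜ _ _ (fun z hz h h' => h (Subtype.ext_iff.1 h')) (hdS' d hd)) hc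
    exact .inr (.inr ⟨n, hn, h.trans hind⟩)
  · push Not at hc
    have hpair : (G.induce (S ∩ S')ᶜ).IsInseparablePair y y' :=
      ⟨hne, hnadj, fun z h1 h2 => z.2 (hno z h1 h2), hj, hc⟩
    rcases hpair.isIndContained hG' with h | h
    · exact .inl (h.trans hind)
    · exact .inr (.inl (h.trans hind))

/-- The structural half of the characterization: minimal cutsets of a chordal graph without the
forbidden induced subgraphs form a 1-Sperner hypergraph. -/
theorem IsChordal.isOneSperner_cutsetHypergraph [Finite V] (hG : G.IsChordal)
    (hF₁ : ¬ graphF1.IsIndContained G) (hF₂ : ¬ graphF2.IsIndContained G)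
    (hH : ∀ n : ℕ, 1 ≤ n → ¬ (graphH n).IsIndContained G) :
    G.cutsetHypergraph.IsOneSperner := by
  intro e he f hf hef
  have hpos : ∀ {e f : Set V}, Minimal G.IsCutset e → Minimal G.IsCutset f → e ≠ f →
      0 < (e \ f).ncard := by
    intro e f he hf hef
    rw [Set.ncard_pos, Set.sdiff_nonempty]
    exact fun hsub => hef (hsub.antisymm (hf.2 he.1 hsub))
  have h1 := hpos he hf hef
  have h2 := hpos hf he hef.symm
  by_contra hmin
  obtain ⟨a, b, ha, hb, hab⟩ := (Set.one_lt_ncard_iff (Set.toFinite (e \ f))).1 (by omega)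
  obtain ⟨a', b', ha', hb', hab'⟩ := (Set.one_lt_ncard_iff (Set.toFinite (f \ e))).1 (by omega)
  rcases hG.isIndContained_of_minimal_isCutset he hf ha hb hab ha' hb' hab' with h | h | ⟨n, hn, h⟩
  exacts [hF₁ h, hF₂ h, hH n hn h]

end SimpleGraph

/-! ### The characterization -/

theorem mainTheorem1 {V : Type*} [Finite V] (G : SimpleGraph V) :
    List.TFAE [
      G.IsHereditarilyConnDomishold,
      ∀ U : Set V, (G.induce U).cutsetHypergraph.IsOneSperner,
      ∀ U : Set V, (G.induce U).cutsetHypergraph.IsThreshold,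
      ∀ U : Set V, (G.induce U).cutsetHypergraph.IsAsummable 2,
      G.IsChordal ∧ ¬ graphF1.IsIndContained G ∧ ¬ graphF2.IsIndContained G ∧
        ∀ i : ℕ, 1 ≤ i → ¬ (graphH i).IsIndContained G] := by
  tfae_have 1 ↔ 3 := forall_congr' fun _ => SimpleGraph.isConnDomishold_iff_isThreshold
  tfae_have 2 → 3 := fun h U => (h U).isThreshold
  tfae_have 3 → 4 := fun h U => (h U).isAsummable rfl 2
  tfae_have 4 → 5 := fun h =>
    have hno (hex : ∃ U : Set V, ¬ (G.induce U).cutsetHypergraph.IsAsummable 2) : False :=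
      hex.elim fun U hU => hU (h U)
    ⟨fun _ hk hc => hno (SimpleGraph.exists_not_isAsummable_of_cycleGraph hk hc),
      fun hF => hno (SimpleGraph.exists_not_isAsummable_of_graphF1 hF),
      fun hF => hno (SimpleGraph.exists_not_isAsummable_of_graphF2 hF),
      fun _ hn hH => hno (SimpleGraph.exists_not_isAsummable_of_graphH hn hH)⟩
  tfae_have 5 → 2 := fun ⟨hG, hF₁, hF₂, hH⟩ U =>
    have hU : (G.induce U).IsIndContained G := ⟨SimpleGraph.Embedding.induce U⟩
    SimpleGraph.IsChordal.isOneSperner_cutsetHypergraph (fun k hk h => hG k hk (h.trans hU))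
      (fun h => hF₁ (h.trans hU)) (fun h => hF₂ (h.trans hU)) fun n hn h => hH n hn (h.trans hU)
  tfae_finish
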